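/- Consider a line network with nodes $v_0,\dots,v_h$, $h\ge 2$, and links $(v_{i-1},v_i)$, $1\le i\le h$. Time is divided into epochs $l=0,1,2,\dots$; in each epoch every node transmits at most one packet on its outgoing link, and link $(v_{i-1},v_i)$ erases it with probability $\varepsilon_i\in(0,1)$, independently over links and epochs. Write $X_i(l)=1$ if link $i$ does not erase in epoch $l$ and $X_i(l)=0$ otherwise. The relay $v_i$, $1\le i\le h-1$, has a buffer of $m_i\ge 1$ packets; the destination $v_h$ has unlimited memory, and the source $v_0$ always has new packets. Nodes transmit first and process receptions afterwards. Put $\mathcal E=(\varepsilon_1,\dots,\varepsilon_h)$, $\mathcal M=(m_1,\dots,m_{h-1})$. **Perfect feedback.** Let packets be elements of a finite alphabet $A$, $|A|\ge 2$. A feedback code conveys a message $w\in\{1,\dots,M\}$ known to the source. In epoch $l$ the source sends a packet depending on $w$ and on all erasure events of epochs $<l$; each relay sends a packet depending on its buffer content (an element of $A^{m_i}$, with initial value independent of $w$) and these erasure events; then each relay replaces its buffer content by a function of the old content, the packet received (if any), and all erasure events of epochs $\le l$. After $L$ epochs the destination decides on a message from everything it received and the erasure events. A rate $R$ is achievable if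 for every $\delta>0$ and all large $L$ there is a feedback code with $M\ge |A|^{RL}$ whose error probability after $L$ epochs, for a uniformly distributed message, is at most $\delta$. Let $\mathcal C^{PF}(\mathcal E,\mathcal M)$ be the supremum of the achievable rates (packets per epoch). **Occupancy chain.** Let $\mathbf n(l)=(n_1(l),\dots,n_{h-1}(l))\in\prod_{i=1}^{h-1}\{0,\dots,m_i\}$ be the Markov chain $n_i(l+1)=n_i(l)+Y_i(l)-Y_{i+1}(l)$, where, for $i=h,h-1,\dots,1$, $Y_i(l)\in\{0,1\}$ equals $1$ if and only if $X_i(l)=1$, $n_{i-1}(l)>0$ (no condition if $i=1$) and $n_i(l)-Y_{i+1}(l)<m_i$ (no condition if $i=h$). **No feedback, random linear network coding over $\mathbb F_q$.** Packets are vectors over $\mathbb F_q$. The source sends in successive epochs the terms of a linearly independent sequence. All $m_i$ slots of $v_i$ initially hold $0$. In each epoch $v_i$ transmits $\sum_k a_kP_k$, where $P_1,\dots,P_{m_i}$ are its slots and $\mathbf a\in\mathbb F_q^{m_i}$ is uniform; if it receives a packet $P$ in that epoch, it then replaces $P_k$ by $P_k+b_kP$ for each $k$, where $\mathbf b\in\mathbb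 F_q^{m_i}$ is uniform. All coefficient vectors and erasures are independent. Let $N(L)$ be the dimension of the span of the packets received by $v_h$ in the first $L$ epochs. **Theorem.** 1. The occupancy chain has a unique stationary distribution $\pi$, and $\mathcal C^{PF}(\mathcal E,\mathcal M)=(1-\varepsilon_h)\,\pi\{\mathbf s: s_{h-1}>0\}$ (for every alphabet $A$). 2. For every finite field $\mathbb F_q$ there is a constant $\mathcal C^{NF}_{\mathbb F_q}(\mathcal E,\mathcal M)$ (independent of the source sequence) with $N(L)/L\to\mathcal C^{NF}_{\mathbb F_q}(\mathcal E,\mathcal M)$ almost surely as $L\to\infty$. 3. For every sequence of finite fields $\mathbb F_{q_l}$ with $q_l\to\infty$, $\displaystyle\lim_{l\to\infty}\mathcal C^{NF}_{\mathbb F_{q_l}}(\mathcal E,\mathcal M)=\mathcal C^{PF}(\mathcal E,\mathcal M)$. -/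

import Mathlib

open MeasureTheory Filter Topology

noncomputable section

namespace LineNetwork

/-! A line network with `r` relays has `r + 2` nodes `0, …, r + 1` and `h = r + 1` links.
Link `j : Fin (r + 1)` goes from node `j` to node `j + 1`. Relay `i : Fin r` is node `i + 1`; it
receives on link `i.castSucc`, transmits on link `i.succ`, and stores `m i` packets.
A channel pattern `x : Fin (r + 1) → Bool` for one epoch has `x j = true` iff link `j` does
NOT erase in that epoch. `ε j` is the erasure probability of link `j`. -/

/-! ### The erasure channels -/

/-- Probability of the channel pattern `x` in one epoch (links are independent). -/
def patternProb {r : ℕ} (ε : Fin (r + 1) → Set.Ioo (0 : ℝ) 1) (x : Fin (r + 1) → Bool) : ℝ :=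
  ∏ j, if x j then 1 - (ε j : ℝ) else (ε j : ℝ)

theorem patternProb_nonneg {r : ℕ} (ε : Fin (r + 1) → Set.Ioo (0 : ℝ) 1)
    (x : Fin (r + 1) → Bool) : 0 ≤ patternProb ε x := by
  refine Finset.prod_nonneg fun j _ => ?_
  have h := (ε j).2
  split_ifs
  · linarith [h.2]
  · exact h.1.le

theorem sum_patternProb {r : ℕ} (ε : Fin (r + 1) → Set.Ioo (0 : ℝ) 1) :
    ∑ x, patternProb ε x = 1 := by
  unfold patternProb
  rw [← Fintype.prod_sum (fun j (b : Bool) => if b then 1 - (ε j : ℝ) else (ε j : ℝ))]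
  simp

/-- Law of the channel pattern of one epoch. -/
def patternPMF {r : ℕ} (ε : Fin (r + 1) → Set.Ioo (0 : ℝ) 1) : PMF (Fin (r + 1) → Bool) :=
  PMF.ofFintype (fun x => ENNReal.ofReal (patternProb ε x)) (by
    rw [← ENNReal.ofReal_sum_of_nonneg fun x _ => patternProb_nonneg ε x, sum_patternProb,
      ENNReal.ofReal_one])

/-- Law of the whole channel process: the patterns of the epochs `0, 1, 2, …` are i.i.d. -/
def channelLaw {r : ℕ} (ε : Fin (r + 1) → Set.Ioo (0 : ℝ) 1) :
    Measure (ℕ → Fin (r + 1) → Bool) :=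
  Measure.infinitePi fun _ => (patternPMF ε).toMeasure

/-! ### Coding with perfect feedback and the throughput capacity -/

/-- The channel patterns of the epochs `0, …, l - 1`. -/
def history {r : ℕ} (ξ : ℕ → Fin (r + 1) → Bool) (l : ℕ) : List (Fin (r + 1) → Bool) :=
  (List.range l).map ξ

/-- A coding scheme with perfect feedback, for packets in `A` and messages in `W`.
All operations may depend on the epoch (the length of the history) and on all erasure events that
have occurred so far. In an epoch every node first transmits a packet formed from what it holds;
after that, with the outcome of the epoch known, every relay updates its buffer from the old buffer
and the packet that it received, if any (`none`: erased). Only the source knows the message, and a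
relay `i` remembers nothing about packets beyond the `m i` packets in its buffer. -/
structure FeedbackCode {r : ℕ} (m : Fin r → ℕ) (A W : Type*) where
  /-- initial buffer contents, independent of the message -/
  init : ∀ i, Fin (m i) → A
  /-- packet sent by the source -/
  source : W → List (Fin (r + 1) → Bool) → A
  /-- packet sent by a relay -/
  relay : ∀ i, List (Fin (r + 1) → Bool) → (Fin (m i) → A) → A
  /-- buffer update of a relay; the history includes the current epoch -/
  update : ∀ i, List (Fin (r + 1) → Bool) → (Fin (m i) → A) → Option A → (Fin (m i) → A)
  /-- decision of the destination, which remembers everything that it received -/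
  decode : List (Fin (r + 1) → Bool) → List (Option A) → W

namespace FeedbackCode

variable {r : ℕ} {m : Fin r → ℕ} {A W : Type*}

/-- The packets transmitted on the links in epoch `l` when the buffers hold `B`. -/
def sent (c : FeedbackCode m A W) (w : W) (ξ : ℕ → Fin (r + 1) → Bool) (l : ℕ)
    (B : ∀ i, Fin (m i) → A) : Fin (r + 1) → A :=
  Fin.cases (c.source w (history ξ l)) fun i => c.relay i (history ξ l) (B i)

/-- Buffer contents at the beginning of each epoch. -/
def buffers (c : FeedbackCode m A W) (w : W) (ξ : ℕ → Fin (r + 1) → Bool) :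
    ℕ → ∀ i, Fin (m i) → A
  | 0 => c.init
  | l + 1 => fun i =>
      c.update i (history ξ (l + 1)) (c.buffers w ξ l i)
        (if ξ l i.castSucc then some (c.sent w ξ l (c.buffers w ξ l) i.castSucc) else none)

/-- What the destination receives in epoch `l`. -/
def received (c : FeedbackCode m A W) (w : W) (ξ : ℕ → Fin (r + 1) → Bool) (l : ℕ) : Option A :=
  if ξ l (Fin.last r) then some (c.sent w ξ l (c.buffers w ξ l) (Fin.last r)) else none

/-- The decision of the destination after the epochs `0, …, L - 1`. -/
def output (c : FeedbackCode m A W) (w : W) (ξ : ℕ → Fin (r + 1) → Bool) (L : ℕ) : W :=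
  c.decode (history ξ L) ((List.range L).map (c.received w ξ))

/-- Error probability after `L` epochs for a uniformly distributed message. -/
def errorProb [Fintype W] (c : FeedbackCode m A W) (ε : Fin (r + 1) → Set.Ioo (0 : ℝ) 1)
    (L : ℕ) : ℝ :=
  (∑ w, (channelLaw ε).real {ξ | c.output w ξ L ≠ w}) / Fintype.card W

end FeedbackCode

/-- The rate `R` (in packets per epoch) is achievable with perfect feedback: for all large `L`,
at least `|A| ^ (R L)` messages can be conveyed in `L` epochs with small error probability. -/
def Achievable {r : ℕ} (A : Type*) [Fintype A] (ε : Fin (r + 1) → Set.Ioo (0 : ℝ) 1)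
    (m : Fin r → ℕ) (R : ℝ) : Prop :=
  ∀ δ > (0 : ℝ), ∀ᶠ L : ℕ in atTop, ∃ M : ℕ, (Fintype.card A : ℝ) ^ (R * L) ≤ M ∧
    ∃ c : FeedbackCode m A (Fin M), c.errorProb ε L ≤ δ

/-- The throughput capacity with perfect feedback, for packets in `A`. -/
def feedbackCapacity {r : ℕ} (A : Type*) [Fintype A] (ε : Fin (r + 1) → Set.Ioo (0 : ℝ) 1)
    (m : Fin r → ℕ) : ℝ :=
  sSup {R : ℝ | Achievable A ε m R}

/-! ### The occupancy chain of the hop-by-hop feedback scheme -/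

/-- With occupancies `s`, the transmitting node of link `j` has a packet to send (always true of
the source). -/
def HasPacket {r : ℕ} (s : Fin r → ℕ) (j : Fin (r + 1)) : Prop :=
  ∀ i : Fin r, i.succ = j → 0 < s i

instance {r : ℕ} (s : Fin r → ℕ) (j : Fin (r + 1)) : Decidable (HasPacket s j) :=
  inferInstanceAs (Decidable (∀ i : Fin r, i.succ = j → 0 < s i))

/-- Whether a packet moves over link `j`, computed from the last link backwards: the link does not
erase, its tail has a packet, and its head (if a relay) has room after its own transmission. -/
def moves {r : ℕ} (m s : Fin r → ℕ) (x : Fin (r + 1) → Bool) (j : Fin (r + 1)) : Bool :=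
  Fin.reverseInduction (motive := fun _ => Bool)
    (x (Fin.last r) && decide (HasPacket s (Fin.last r)))
    (fun i y => x i.castSucc && decide (HasPacket s i.castSucc) && decide (s i < m i + y.toNat))
    j

/-- The occupancies after the epoch. -/
def nextOccupancy {r : ℕ} (m s : Fin r → ℕ) (x : Fin (r + 1) → Bool) (i : Fin r) : ℕ :=
  s i + (moves m s x i.castSucc).toNat - (moves m s x i.succ).toNat

/-- Transition matrix of the occupancy chain on `∏ i, {0, …, m i}`. -/
def transition {r : ℕ} (ε : Fin (r + 1) → Set.Ioo (0 : ℝ) 1) (m : Fin r → ℕ) :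
    Matrix (∀ i, Fin (m i + 1)) (∀ i, Fin (m i + 1)) ℝ :=
  fun s s' => ∑ x, if nextOccupancy m (fun i => s i) x = (fun i => (s' i : ℕ))
    then patternProb ε x else 0

/-- Stationary probability distributions of the occupancy chain. -/
def IsStationary {r : ℕ} (ε : Fin (r + 1) → Set.Ioo (0 : ℝ) 1) (m : Fin r → ℕ)
    (π : (∀ i, Fin (m i + 1)) → ℝ) : Prop :=
  π ∈ stdSimplex ℝ (∀ i, Fin (m i + 1)) ∧ Matrix.vecMul π (transition ε m) = π

/-! ### Random linear network coding without feedback -/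

/-- The randomness of one epoch: channel pattern `ok`, and for every relay the vector `a` that
forms its outgoing packet and the vector `b` that adds a received packet to its slots. -/
structure CodingEpoch {r : ℕ} (m : Fin r → ℕ) (F : Type*) where
  ok : Fin (r + 1) → Bool
  a : ∀ i, Fin (m i) → F
  b : ∀ i, Fin (m i) → F

instance {r : ℕ} (m : Fin r → ℕ) (F : Type*) : MeasurableSpace (CodingEpoch m F) := ⊤

/-- The channel pattern and all coefficients are independent, the coefficients uniform on `F`. -/
def codingEpochPMF {r : ℕ} (ε : Fin (r + 1) → Set.Ioo (0 : ℝ) 1) (m : Fin r → ℕ)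
    (F : Type*) [Field F] [Fintype F] : PMF (CodingEpoch m F) :=
  (patternPMF ε).bind fun x =>
    (PMF.uniformOfFintype (∀ i, Fin (m i) → F)).bind fun a =>
      (PMF.uniformOfFintype (∀ i, Fin (m i) → F)).map fun b => ⟨x, a, b⟩

/-- The epochs are i.i.d. -/
def codingLaw {r : ℕ} (ε : Fin (r + 1) → Set.Ioo (0 : ℝ) 1) (m : Fin r → ℕ)
    (F : Type*) [Field F] [Fintype F] : Measure (ℕ → CodingEpoch m F) :=
  Measure.infinitePi fun _ => (codingEpochPMF ε m F).toMeasure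

section RLNC

variable {r : ℕ} {m : Fin r → ℕ} {F V : Type*} [Field F] [AddCommGroup V] [Module F V]

/-- The packets transmitted on the links when the buffers hold `B` and the source sends `p`. -/
def rlncSent (z : CodingEpoch m F) (p : V) (B : ∀ i, Fin (m i) → V) : Fin (r + 1) → V :=
  Fin.cases p fun i => ∑ k, z.a i k • B i k

/-- Buffer contents at the beginning of each epoch; `src l` is the source packet of epoch `l`. -/
def rlncBuffers (src : ℕ → V) (z : ℕ → CodingEpoch m F) : ℕ → ∀ i, Fin (m i) → V
  | 0 => fun _ _ => 0
  | l + 1 => fun i k =>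
      rlncBuffers src z l i k +
        if (z l).ok i.castSucc then
          (z l).b i k • rlncSent (z l) (src l) (rlncBuffers src z l) i.castSucc
        else 0

/-- Number of innovative packets received by the destination in the epochs `0, …, L - 1`, that is,
the dimension of the span of the packets received. -/
def innovative (src : ℕ → V) (z : ℕ → CodingEpoch m F) (L : ℕ) : ℕ :=
  Module.finrank F (Submodule.span F
    {p : V | ∃ l < L, (z l).ok (Fin.last r) = true ∧
      p = rlncSent (z l) (src l) (rlncBuffers src z l) (Fin.last r)})

end RLNC

/-- `c` is the asymptotic rate at which innovative packets reach the destination under random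
linear network coding over `F` without feedback, whatever the (linearly independent) packets
`src 0, src 1, …` that the source injects. -/
def IsInnovationRate.{u, v} {r : ℕ} (ε : Fin (r + 1) → Set.Ioo (0 : ℝ) 1) (m : Fin r → ℕ)
    (F : Type u) [Field F] [Fintype F] (c : ℝ) : Prop :=
  ∀ (V : Type v) [AddCommGroup V] [Module F V] (src : ℕ → V), LinearIndependent F src →
    ∀ᵐ z ∂(codingLaw ε m F),
      Tendsto (fun L : ℕ => (innovative src z L : ℝ) / L) atTop (𝓝 c)

end LineNetwork

end

/-!
Three quantities are compared: the flow of a deterministic queueing recursion, the number of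
packets that determine what a part of the network knows, and the rank of random linear
combinations.

*The flow.* Let `D_j(t)` be the number of packets that the occupancy chain, started empty, has
moved over link `j` before epoch `t`. Then `D_j(t+1) = min (D_j(t) + x_j(t)) (D_{j-1}(t))
(D_{j+1}(t+1) + m)`, where `m` is the buffer size at the head of link `j` (the second
term is absent at the first link, the third at the last). Every quantity that obeys the three
corresponding inequalities is therefore at most `D_j`; `flow_induction` states this as an
induction principle. The chain is a finite chain driven by i.i.d. symbols, in which the empty
state can be reached from everywhere. Hence its Poisson equation is solvable (`exists_poissonEq`,
by the maximum principle), which yields the unique stationary distribution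
(`existsUnique_stationary`) and a strong law with the stationary mean as its limit
(`PoissonEq.ae_tendsto`, by orthogonal increments). So the flow into the destination has a rate
`C`, which is the claimed expression (`PoissonEq.eq_throughput`).

*Perfect feedback.* For a fixed erasure pattern, all that the nodes behind link `j` hold at time
`t` is a function of `D_j(t)` packets (`exists_description`, by the induction principle), so at
most `|A| ^ D(L)` messages are decoded correctly. Conversely the occupancy chain is the
bookkeeping of hop-by-hop forwarding, which delivers `D(L)` packets (`forwarding_output`).
Therefore the capacity is `C` (`feedbackCapacity_eq`).

*Network coding.* Which combinations of the stored packets are known to the destination is a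
subspace of a fixed finite coefficient space. These subspaces form another finite chain driven by
i.i.d. symbols, independent of the source packets, whose reward counts the innovative packets
(`innovative_eq_sum`), and the full space is reached from everywhere (`reachable_nextKnown`). The
strong law gives the rate. It is at most `C`, since the dimensions behind the links obey the
inequalities of the flow (`innovative_le_flow`). If the coefficients of an epoch avoid certain
proper affine subspaces, which happens with probability at least `1 - 2 r / q`, then these
dimensions follow the recursion of the flow exactly (`finrank_behind_step`). So from the full
space the expected number of innovative packets in `T` epochs is at least the expected flow minus
`T ^ 2 * 2 r / q`. The dynamics are monotone in the subspace, so that every other initial state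
does at least as well, and `1 / T` times this bound is a lower bound of the rate
(`exists_innovationRate`). Letting first `q` and then `T` tend to infinity gives the limit `C`.
-/

noncomputable section

namespace LineNetwork

/-! ### Finite chains driven by i.i.d. symbols -/

section Driven

variable {S Z : Type*} [Fintype Z]

/-- Poisson equation, in the form `𝔼 [g s z + h (f s z)] = c + h s`, of the chain `s ↦ f s z` that
is driven by symbols `z` of weights `μ z`: `c` is the mean reward per step, for the reward `g s z`
of a step, and `h` is the relative value of a state. -/
def PoissonEq (μ : Z → ℝ) (f : S → Z → S) (g : S → Z → ℝ) (c : ℝ) (h : S → ℝ) : Prop :=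
  ∀ s, ∑ z, μ z * (g s z + h (f s z)) = c + h s

/-- The state `s₀` can be reached from everywhere. -/
def Reachable (f : S → Z → S) (s₀ : S) : Prop :=
  ∀ s, Relation.ReflTransGen (fun s t => ∃ z, f s z = t) s s₀

theorem sum_weight_mul_le {μ : Z → ℝ} (hpos : ∀ z, 0 < μ z) (hsum : ∑ z, μ z = 1)
    {φ : Z → ℝ} {b : ℝ} (h : ∀ z, φ z ≤ b) : ∑ z, μ z * φ z ≤ b := by
  calc ∑ z, μ z * φ z ≤ ∑ z, μ z * b :=
        Finset.sum_le_sum fun z _ => mul_le_mul_of_nonneg_left (h z) (hpos z).le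
    _ = b := by rw [← Finset.sum_mul, hsum, one_mul]

theorem le_sum_weight_mul {μ : Z → ℝ} (hpos : ∀ z, 0 < μ z) (hsum : ∑ z, μ z = 1)
    {φ : Z → ℝ} {b : ℝ} (h : ∀ z, b ≤ φ z) : b ≤ ∑ z, μ z * φ z := by
  calc b = ∑ z, μ z * b := by rw [← Finset.sum_mul, hsum, one_mul]
    _ ≤ ∑ z, μ z * φ z :=
        Finset.sum_le_sum fun z _ => mul_le_mul_of_nonneg_left (h z) (hpos z).le

/-- A maximum of a harmonic function propagates to everything that can be reached from it. -/
theorem harmonic_eq_of_reach {μ : Z → ℝ} (hpos : ∀ z, 0 < μ z) (hsum : ∑ z, μ z = 1)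
    {f : S → Z → S} {h : S → ℝ} (hh : ∀ s, ∑ z, μ z * h (f s z) = h s) {s t : S}
    (hmax : ∀ s', h s' ≤ h s) (hst : Relation.ReflTransGen (fun s t => ∃ z, f s z = t) s t) :
    h t = h s := by
  induction hst with
  | refl => rfl
  | @tail u v _ huv ih =>
    obtain ⟨z, rfl⟩ := huv
    have h0 : ∑ z, μ z * (h s - h (f u z)) = 0 := by
      simp only [mul_sub, Finset.sum_sub_distrib, hh u, ← Finset.sum_mul, hsum, ih]
      ring
    have h1 := (Finset.sum_eq_zero_iff_of_nonneg fun z _ =>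
      mul_nonneg (hpos z).le (sub_nonneg.2 (hmax (f u z)))).1 h0 z (Finset.mem_univ z)
    rcases mul_eq_zero.1 h1 with h2 | h2
    · exact absurd h2 (hpos z).ne'
    · linarith

/-- Expected total reward of the first `T` steps, as a function of the initial state. -/
def totalReward (μ : Z → ℝ) (f : S → Z → S) (g : S → Z → ℝ) : ℕ → S → ℝ
  | 0 => fun _ => 0
  | T + 1 => fun s => ∑ z, μ z * (g s z + totalReward μ f g T (f s z))

theorem totalReward_le {μ : Z → ℝ} (hpos : ∀ z, 0 < μ z) (hsum : ∑ z, μ z = 1)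
    {f : S → Z → S} {g : S → Z → ℝ} {c : ℝ} {h : S → ℝ} (hP : PoissonEq μ f g c h) {b : ℝ}
    (hb : ∀ s, b ≤ h s) (T : ℕ) (s : S) : totalReward μ f g T s ≤ T * c + h s - b := by
  induction T generalizing s with
  | zero => simpa [totalReward] using hb s
  | succ T ih =>
    have h1 : totalReward μ f g (T + 1) s ≤
        ∑ z, μ z * ((g s z + h (f s z)) + (T * c - b)) :=
      Finset.sum_le_sum fun z _ => mul_le_mul_of_nonneg_left (by linarith [ih (f s z)]) (hpos z).le
    simp only [mul_add _ (_ + _) (_ - _), Finset.sum_add_distrib, hP s, ← Finset.sum_mul, hsum]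
      at h1
    push_cast
    linarith

theorem le_totalReward {μ : Z → ℝ} (hpos : ∀ z, 0 < μ z) (hsum : ∑ z, μ z = 1)
    {f : S → Z → S} {g : S → Z → ℝ} {c : ℝ} {h : S → ℝ} (hP : PoissonEq μ f g c h) {b : ℝ}
    (hb : ∀ s, h s ≤ b) (T : ℕ) (s : S) : T * c + h s - b ≤ totalReward μ f g T s := by
  induction T generalizing s with
  | zero => simpa [totalReward] using hb s
  | succ T ih =>
    have h1 : ∑ z, μ z * ((g s z + h (f s z)) + (T * c - b)) ≤ totalReward μ f g (T + 1) s :=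
      Finset.sum_le_sum fun z _ => mul_le_mul_of_nonneg_left (by linarith [ih (f s z)]) (hpos z).le
    simp only [mul_add _ (_ + _) (_ - _), Finset.sum_add_distrib, hP s, ← Finset.sum_mul, hsum]
      at h1
    push_cast
    linarith

variable [Fintype S]

/-- The Poisson equation is solvable when some state can be reached from all others: by the maximum
principle the operator `h ↦ h - P h + h s₀` is injective, hence surjective. -/
theorem exists_poissonEq {μ : Z → ℝ} (hpos : ∀ z, 0 < μ z) (hsum : ∑ z, μ z = 1)
    {f : S → Z → S} {s₀ : S} (hreach : Reachable f s₀) (g : S → Z → ℝ) :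
    ∃ c h, PoissonEq μ f g c h := by
  classical
  have : Nonempty S := ⟨s₀⟩
  let Ψ : (S → ℝ) →ₗ[ℝ] (S → ℝ) :=
    { toFun := fun h s => h s - ∑ z, μ z * h (f s z) + h s₀
      map_add' := fun h k => by
        ext s
        simp only [Pi.add_apply, mul_add, Finset.sum_add_distrib]
        ring
      map_smul' := fun a h => by
        ext s
        simp only [Pi.smul_apply, smul_eq_mul, RingHom.id_apply, mul_left_comm _ a,
          ← Finset.mul_sum]
        ring }
  have hΨ : Function.Injective Ψ := by
    rw [← LinearMap.ker_eq_bot, LinearMap.ker_eq_bot']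
    intro h hh
    have hh' : ∀ s, h s - ∑ z, μ z * h (f s z) + h s₀ = 0 := fun s => congrFun hh s
    obtain ⟨a, ha⟩ := Finite.exists_max h
    obtain ⟨b, hb⟩ := Finite.exists_min h
    have h1 : h s₀ ≤ 0 := by
      have := sum_weight_mul_le hpos hsum fun z => ha (f a z)
      linarith [hh' a]
    have h2 : 0 ≤ h s₀ := by
      have := le_sum_weight_mul hpos hsum fun z => hb (f b z)
      linarith [hh' b]
    have h0 : h s₀ = 0 := le_antisymm h1 h2
    have hharm : ∀ s, ∑ z, μ z * h (f s z) = h s := fun s => by linarith [hh' s]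
    have hharm' : ∀ s, ∑ z, μ z * (-h) (f s z) = (-h) s := fun s => by
      simp only [Pi.neg_apply, mul_neg, Finset.sum_neg_distrib, hharm s]
    have e1 := harmonic_eq_of_reach hpos hsum hharm ha (hreach a)
    have e2 := harmonic_eq_of_reach hpos hsum hharm' (fun s => neg_le_neg (hb s)) (hreach b)
    simp only [Pi.neg_apply, neg_inj] at e2
    ext s
    exact le_antisymm ((ha s).trans (by rw [← e1, h0]; rfl))
      (le_trans (by rw [← e2, h0]; rfl) (hb s))
  obtain ⟨h, hh⟩ := (LinearMap.injective_iff_surjective.1 hΨ) fun s => ∑ z, μ z * g s z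
  refine ⟨h s₀, h, fun s => ?_⟩
  have : h s - ∑ z, μ z * h (f s z) + h s₀ = ∑ z, μ z * g s z := congrFun hh s
  simp only [mul_add, Finset.sum_add_distrib]
  linarith

/-- The mean reward is unique: at a minimum of the difference of two relative values, that
difference cannot decrease on average. -/
theorem PoissonEq.unique [Nonempty S] {μ : Z → ℝ} (hpos : ∀ z, 0 < μ z) (hsum : ∑ z, μ z = 1)
    {f : S → Z → S} {g : S → Z → ℝ} {c c' : ℝ} {k k' : S → ℝ} (h1 : PoissonEq μ f g c k)
    (h2 : PoissonEq μ f g c' k') : c = c' := by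
  have hle : ∀ {c c' : ℝ} {k k' : S → ℝ}, PoissonEq μ f g c k → PoissonEq μ f g c' k' →
      c ≤ c' := by
    intro c c' k k' h1 h2
    obtain ⟨s, hs⟩ := Finite.exists_min (fun s => k' s - k s)
    have h3 : ∑ z, μ z * (k' (f s z) - k (f s z)) = (c' + k' s) - (c + k s) := by
      rw [← h1 s, ← h2 s, ← Finset.sum_sub_distrib]
      exact Finset.sum_congr rfl fun z _ => by ring
    have h4 := le_sum_weight_mul hpos hsum fun z => hs (f s z)
    rw [h3] at h4
    linarith
  exact le_antisymm (hle h1 h2) (hle h2 h1)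

/-- A state of minimal expected reward bounds the mean reward from below. -/
theorem totalReward_le_of_forall_le [Nonempty S] {μ : Z → ℝ} (hpos : ∀ z, 0 < μ z)
    (hsum : ∑ z, μ z = 1) {f : S → Z → S} {g : S → Z → ℝ} {c : ℝ} {h : S → ℝ}
    (hP : PoissonEq μ f g c h) {T : ℕ} {s₀ : S}
    (hs₀ : ∀ s, totalReward μ f g T s₀ ≤ totalReward μ f g T s) :
    totalReward μ f g T s₀ ≤ T * c := by
  obtain ⟨s, hs⟩ := Finite.exists_min h
  linarith [totalReward_le hpos hsum hP hs T s, hs₀ s]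

/-- Summing the Poisson equation against a stationary distribution identifies the mean reward. -/
theorem PoissonEq.eq_sum_stationary {μ : Z → ℝ} {f : S → Z → S} {g : S → Z → ℝ} {c : ℝ}
    {h : S → ℝ} (hP : PoissonEq μ f g c h) {π : S → ℝ} (hπ : ∑ s, π s = 1)
    (hstat : ∀ φ : S → ℝ, ∑ s, π s * ∑ z, μ z * φ (f s z) = ∑ s, π s * φ s) :
    c = ∑ s, π s * ∑ z, μ z * g s z := by
  have h1 : ∑ s, π s * ∑ z, μ z * (g s z + h (f s z)) = ∑ s, π s * (c + h s) :=
    Finset.sum_congr rfl fun s _ => by rw [hP s]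
  simp only [mul_add, Finset.sum_add_distrib, hstat h, ← Finset.sum_mul, hπ] at h1
  linarith

/-- Existence and uniqueness of the stationary distribution: its value at `a` is the mean reward
for the reward `1_{s = a}`. -/
theorem existsUnique_stationary {μ : Z → ℝ} (hpos : ∀ z, 0 < μ z) (hsum : ∑ z, μ z = 1)
    {f : S → Z → S} {s₀ : S} (hreach : Reachable f s₀) :
    ∃! π : S → ℝ, π ∈ stdSimplex ℝ S ∧
      ∀ φ : S → ℝ, ∑ s, π s * ∑ z, μ z * φ (f s z) = ∑ s, π s * φ s := by
  classical
  have : Nonempty S := ⟨s₀⟩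
  have hex : ∀ a : S, ∃ c h, PoissonEq μ f (fun s _ => if s = a then (1 : ℝ) else 0) c h :=
    fun a => exists_poissonEq hpos hsum hreach _
  choose π h hP using hex
  have hlin : ∀ φ : S → ℝ, PoissonEq μ f (fun s _ => φ s) (∑ a, π a * φ a)
      (fun s => ∑ a, h a s * φ a) := by
    intro φ s
    have e : ∀ z, φ s + ∑ a, h a (f s z) * φ a =
        ∑ a, ((if s = a then (1 : ℝ) else 0) + h a (f s z)) * φ a := by
      intro z
      simp [add_mul, Finset.sum_add_distrib]
    simp only [e, Finset.mul_sum]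
    rw [Finset.sum_comm, ← Finset.sum_add_distrib]
    refine Finset.sum_congr rfl fun a _ => ?_
    rw [← add_mul, ← hP a s, Finset.sum_mul]
    exact Finset.sum_congr rfl fun z _ => by ring
  refine ⟨π, ⟨⟨fun a => ?_, ?_⟩, fun φ => ?_⟩, ?_⟩
  · obtain ⟨s, hs⟩ := Finite.exists_min (h a)
    have h1 : h a s ≤ ∑ z, μ z * ((if s = a then (1 : ℝ) else 0) + h a (f s z)) :=
      le_sum_weight_mul hpos hsum fun z => (hs (f s z)).trans
        (le_add_of_nonneg_left (by split_ifs <;> norm_num))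
    have h2 := hP a s
    linarith
  · have h1 := hlin fun _ => 1
    have h2 : PoissonEq μ f (fun _ _ => (1 : ℝ)) 1 (fun _ : S => 0) := fun s => by
      simp [hsum]
    simpa using h1.unique hpos hsum h2
  · have h1 := hlin φ
    have h2 := hlin fun s => ∑ z, μ z * φ (f s z)
    refine (h1.unique hpos hsum (c' := ∑ a, π a * ∑ z, μ z * φ (f a z))
      (k' := fun s => φ s + ∑ a, h a s * ∑ z, μ z * φ (f a z)) fun s => ?_).symm
    have h3 := h2 s
    simp only at h3
    have e : ∑ z, μ z * (φ s + (φ (f s z) + ∑ a, h a (f s z) * ∑ z, μ z * φ (f a z))) =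
        φ s + ∑ z, μ z * (∑ z, μ z * φ (f s z) + ∑ a, h a (f s z) * ∑ z, μ z * φ (f a z)) := by
      simp only [mul_add, Finset.sum_add_distrib, ← Finset.sum_mul, hsum, one_mul]
    rw [e, h3]
    ring
  · rintro π' ⟨⟨_, hs⟩, hstat⟩
    ext a
    rw [(hP a).eq_sum_stationary hs hstat]
    simp [hsum]

end Driven

/-! ### The strong law for additive rewards -/

section StrongLaw

variable {S Z : Type*}

/-- States visited from `s₀` under the symbols `z 0, z 1, …`. -/
def trajectory (f : S → Z → S) (s₀ : S) (z : ℕ → Z) : ℕ → S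
  | 0 => s₀
  | l + 1 => f (trajectory f s₀ z l) (z l)

theorem dependsOn_trajectory (f : S → Z → S) (s₀ : S) (L : ℕ) :
    DependsOn (fun z => trajectory f s₀ z L) (Finset.range L : Set ℕ) := by
  intro z z' h
  induction L with
  | zero => rfl
  | succ L ih =>
    simp only [trajectory]
    have h1 : trajectory f s₀ z L = trajectory f s₀ z' L :=
      ih fun i hi => h i (by simp at hi ⊢; omega)
    rw [h1, h L (by simp)]

theorem dependsOn_sum_trajectory (f : S → Z → S) (s₀ : S) (d : S → Z → ℝ) (L : ℕ) :
    DependsOn (fun z => ∑ l ∈ Finset.range L, d (trajectory f s₀ z l) (z l))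
      (Finset.range L : Set ℕ) := by
  intro z z' h
  refine Finset.sum_congr rfl fun l hl => ?_
  have h1 : trajectory f s₀ z l = trajectory f s₀ z' l := by
    refine dependsOn_trajectory f s₀ l fun i hi => h i ?_
    simp only [Finset.coe_range, Set.mem_Iio, Finset.mem_range] at hi hl ⊢
    omega
  rw [h l hl, h1]

theorem abs_sum_trajectory_le {f : S → Z → S} {s₀ : S} {d : S → Z → ℝ} {K : ℝ}
    (hK : ∀ s z, |d s z| ≤ K) (z : ℕ → Z) (A : Finset ℕ) :
    |∑ l ∈ A, d (trajectory f s₀ z l) (z l)| ≤ A.card * K := by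
  refine (Finset.abs_sum_le_sum_abs _ _).trans ?_
  refine (Finset.sum_le_card_nsmul _ _ K fun l _ => hK _ _).trans ?_
  simp

variable [MeasurableSpace Z] [Finite Z] [MeasurableSingletonClass Z]

theorem measurable_of_dependsOn {X : Type*} [MeasurableSpace X] {φ : (ℕ → Z) → X} {L : ℕ}
    (hφ : DependsOn φ (Finset.range L : Set ℕ)) : Measurable φ := by
  rcases isEmpty_or_nonempty Z with hZ | ⟨⟨z₀⟩⟩
  · exact measurable_of_empty φ
  · have : Nonempty X := ⟨φ fun _ => z₀⟩
    obtain ⟨ψ, rfl⟩ := dependsOn_iff_exists_comp.1 hφ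
    have : Finite ((Finset.range L : Finset ℕ) : Set ℕ) := Finset.finite_toSet _
    exact (measurable_of_finite ψ).comp (measurable_pi_lambda _ fun i => measurable_pi_apply _)

theorem integral_eval_infinitePi [Fintype Z] (ν : Measure Z) [IsProbabilityMeasure ν] (L : ℕ)
    (u : Z → ℝ) :
    ∫ z, u (z L) ∂(Measure.infinitePi fun _ : ℕ => ν) = ∑ x, ν.real {x} * u x := by
  have h := Measure.infinitePi_map_eval (fun _ : ℕ => ν) L
  rw [← integral_map (φ := fun z : ℕ → Z => z L) (f := u) (measurable_pi_apply L).aemeasurable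
    (measurable_of_finite u).aestronglyMeasurable, h, integral_fintype (Integrable.of_finite)]
  simp

/-- What is determined by the first `L` symbols is independent of the symbol number `L`. -/
theorem integral_mul_eval_infinitePi (ν : Measure Z) [IsProbabilityMeasure ν] {L : ℕ}
    {φ : (ℕ → Z) → ℝ} (hφ : DependsOn φ (Finset.range L : Set ℕ)) (u : Z → ℝ) :
    ∫ z, φ z * u (z L) ∂(Measure.infinitePi fun _ : ℕ => ν) =
      (∫ z, φ z ∂(Measure.infinitePi fun _ : ℕ => ν)) *
        ∫ z, u (z L) ∂(Measure.infinitePi fun _ : ℕ => ν) := by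
  obtain ⟨ψ, rfl⟩ := dependsOn_iff_exists_comp.1 hφ
  have hind := (ProbabilityTheory.iIndepFun_infinitePi (P := fun _ : ℕ => ν)
    (X := fun _ => id) fun _ => measurable_id).indepFun_finset (Finset.range L) {L} (by simp)
    fun i => measurable_pi_apply i
  have : Finite ((Finset.range L : Finset ℕ) : Set ℕ) := Finset.finite_toSet _
  exact hind.integral_fun_comp_mul_comp (f := ψ)
    (g := fun y : (i : ({L} : Finset ℕ)) → Z => u (y ⟨L, by simp⟩))
    (measurable_pi_lambda _ fun i => measurable_pi_apply _).aemeasurable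
    (measurable_pi_lambda _ fun i => measurable_pi_apply _).aemeasurable
    (measurable_of_finite ψ).aestronglyMeasurable
    (measurable_of_finite _).aestronglyMeasurable

theorem integrable_of_dependsOn {ν : Measure Z} [IsProbabilityMeasure ν] {φ : (ℕ → Z) → ℝ} {L : ℕ}
    (hφ : DependsOn φ (Finset.range L : Set ℕ)) {K : ℝ} (hK : ∀ z, |φ z| ≤ K) :
    Integrable φ (Measure.infinitePi fun _ : ℕ => ν) :=
  Integrable.of_bound (measurable_of_dependsOn hφ).aestronglyMeasurable K
    (ae_of_all _ fun z => by simpa using hK z)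

/-- Increments with zero conditional mean are orthogonal, so the second moment of their sum grows
at most linearly. -/
theorem integral_sq_sum_trajectory_le [Fintype Z] [Fintype S] (ν : Measure Z)
    [IsProbabilityMeasure ν] (f : S → Z → S) (s₀ : S) (d : S → Z → ℝ)
    (hd : ∀ s, ∑ z, ν.real {z} * d s z = 0) {K : ℝ} (hK : ∀ s z, |d s z| ≤ K) (L : ℕ) :
    ∫ z, (∑ l ∈ Finset.range L, d (trajectory f s₀ z l) (z l)) ^ 2
      ∂(Measure.infinitePi fun _ : ℕ => ν) ≤ L * K ^ 2 := by
  classical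
  induction L with
  | zero => simp
  | succ L ih =>
    set P := Measure.infinitePi fun _ : ℕ => ν
    set M : (ℕ → Z) → ℝ := fun z => ∑ l ∈ Finset.range L, d (trajectory f s₀ z l) (z l) with hM
    have hMdep : DependsOn M (Finset.range L : Set ℕ) := dependsOn_sum_trajectory f s₀ d L
    have hMb : ∀ z, |M z| ≤ L * K := fun z => by
      simpa using abs_sum_trajectory_le hK z (Finset.range L)
    have hK0 : 0 ≤ K := by
      have : Nonempty Z := ν.nonempty_of_neZero
      obtain ⟨z⟩ := this
      exact (abs_nonneg _).trans (hK s₀ z)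
    have hsplit : ∀ z, M z * d (trajectory f s₀ z L) (z L) =
        ∑ s, (M z * if trajectory f s₀ z L = s then 1 else 0) * d s (z L) := by
      intro z
      simp [mul_ite, ite_mul]
    have hdep : ∀ s, DependsOn (fun z => M z * if trajectory f s₀ z L = s then (1 : ℝ) else 0)
        (Finset.range L : Set ℕ) := fun s z z' h => by
      have h1 := hMdep h
      have h2 := dependsOn_trajectory f s₀ L h
      simp only at h2 ⊢
      rw [h1, h2]
    have hcross : ∫ z, M z * d (trajectory f s₀ z L) (z L) ∂P = 0 := by
      simp only [hsplit]
      rw [integral_finsetSum]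
      · refine Finset.sum_eq_zero fun s _ => ?_
        rw [integral_mul_eval_infinitePi ν (hdep s), integral_eval_infinitePi, hd s, mul_zero]
      · intro s _
        refine integrable_of_dependsOn (L := L + 1) (K := L * K * K) (fun z z' h => ?_) fun z => ?_
        · have h1 := hdep s fun i hi => h i (by simp at hi ⊢; omega)
          simp only at h1 ⊢
          rw [h1, h L (by simp)]
        · rw [abs_mul]
          refine mul_le_mul ?_ (hK _ _) (abs_nonneg _) (by positivity)
          rw [abs_mul]
          refine (mul_le_of_le_one_right (abs_nonneg _) ?_).trans (hMb z)
          split_ifs <;> simp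
    have hsq : ∀ z, (∑ l ∈ Finset.range (L + 1), d (trajectory f s₀ z l) (z l)) ^ 2 ≤
        M z ^ 2 + 2 * (M z * d (trajectory f s₀ z L) (z L)) + K ^ 2 := by
      intro z
      rw [Finset.sum_range_succ]
      have h1 : d (trajectory f s₀ z L) (z L) ^ 2 ≤ K ^ 2 := sq_le_sq' (abs_le.1 (hK _ _)).1
        (abs_le.1 (hK _ _)).2
      change (M z + _) ^ 2 ≤ _
      nlinarith
    have hi1 : Integrable (fun z => M z ^ 2) P := by
      refine integrable_of_dependsOn (L := L) (K := (L * K) ^ 2) (fun z z' h => ?_) fun z => ?_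
      · simp only [hMdep h]
      · rw [abs_pow]
        exact pow_le_pow_left₀ (abs_nonneg _) (hMb z) 2
    have hi2 : Integrable (fun z => M z * d (trajectory f s₀ z L) (z L)) P := by
      refine integrable_of_dependsOn (L := L + 1) (K := L * K * K) (fun z z' h => ?_) fun z => ?_
      · have h0 : ∀ i ∈ (Finset.range L : Set ℕ), z i = z' i :=
          fun i hi => h i (by simp at hi ⊢; omega)
        have h1 := hMdep h0
        have h2 := dependsOn_trajectory f s₀ L h0
        simp only at h2 ⊢
        rw [h1, h2, h L (by simp)]
      · rw [abs_mul]
        exact mul_le_mul (hMb z) (hK _ _) (abs_nonneg _) (by positivity)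
    calc _ ≤ ∫ z, (M z ^ 2 + 2 * (M z * d (trajectory f s₀ z L) (z L)) + K ^ 2) ∂P := by
            refine integral_mono_of_nonneg (ae_of_all _ fun z => sq_nonneg _) ?_
              (ae_of_all _ hsq)
            exact (hi1.add (hi2.const_mul 2)).add (integrable_const _)
      _ = (∫ z, M z ^ 2 ∂P) + K ^ 2 := by
            have hi3 := hi1.add (hi2.const_mul 2)
            simp only [Pi.add_def] at hi3
            rw [integral_add hi3 (integrable_const _), integral_add hi1 (hi2.const_mul 2),
              integral_const_mul, hcross]
            simp
      _ ≤ _ := by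
            push_cast
            linarith

/-- Second moments bounded by `L K²` make the sums `o(L)` along the squares almost surely, by
summability, and bounded increments fill the gaps between squares. -/
theorem ae_tendsto_sum_trajectory_div [Fintype Z] [Fintype S] (ν : Measure Z)
    [IsProbabilityMeasure ν] (f : S → Z → S) (s₀ : S) (d : S → Z → ℝ)
    (hd : ∀ s, ∑ z, ν.real {z} * d s z = 0) :
    ∀ᵐ z ∂(Measure.infinitePi fun _ : ℕ => ν), Tendsto
      (fun L : ℕ => (∑ l ∈ Finset.range L, d (trajectory f s₀ z l) (z l)) / L) atTop (𝓝 0) := by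
  set P := Measure.infinitePi fun _ : ℕ => ν
  have : Nonempty S := ⟨s₀⟩
  have : Nonempty Z := ν.nonempty_of_neZero
  obtain ⟨p, hp⟩ := Finite.exists_max fun p : S × Z => |d p.1 p.2|
  set K := |d p.1 p.2|
  have hK : ∀ s z, |d s z| ≤ K := fun s z => hp (s, z)
  have hK0 : 0 ≤ K := abs_nonneg _
  set M : ℕ → (ℕ → Z) → ℝ := fun L z => ∑ l ∈ Finset.range L, d (trajectory f s₀ z l) (z l)
    with hM
  have hdep : ∀ L, DependsOn (fun z => (M L z / L) ^ 2) (Finset.range L : Set ℕ) :=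
    fun L z z' h => by simp only [hM, dependsOn_sum_trajectory f s₀ d L h]
  have hint : ∀ L, Integrable (fun z => (M L z / L) ^ 2) P := fun L => by
    refine integrable_of_dependsOn (hdep L) (K := (L * K / L) ^ 2) fun z => ?_
    rw [abs_pow, abs_div, Nat.abs_cast]
    refine pow_le_pow_left₀ (by positivity) (div_le_div_of_nonneg_right ?_ (by positivity)) 2
    simpa using abs_sum_trajectory_le hK z (Finset.range L)
  have hbound : ∀ n : ℕ, ∫⁻ z, ENNReal.ofReal ((M (n ^ 2) z / (n ^ 2 : ℕ)) ^ 2) ∂P ≤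
      ENNReal.ofReal (K ^ 2 * (1 / (n : ℝ) ^ 2)) := by
    intro n
    rw [← ofReal_integral_eq_lintegral_ofReal (hint _) (ae_of_all _ fun z => sq_nonneg _)]
    refine ENNReal.ofReal_le_ofReal ?_
    simp only [div_pow, integral_div]
    have h1 := integral_sq_sum_trajectory_le ν f s₀ d hd hK (n ^ 2)
    rcases Nat.eq_zero_or_pos n with rfl | hn
    · simp
    · rw [div_le_iff₀ (by positivity)]
      refine h1.trans (le_of_eq ?_)
      push_cast
      field_simp
  have hsumm : ∑' n : ℕ, ∫⁻ z, ENNReal.ofReal ((M (n ^ 2) z / (n ^ 2 : ℕ)) ^ 2) ∂P ≠ ⊤ := by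
    refine ne_top_of_le_ne_top ?_ (ENNReal.tsum_le_tsum hbound)
    rw [← ENNReal.ofReal_tsum_of_nonneg (fun n => by positivity)
      ((Real.summable_one_div_nat_pow.2 one_lt_two).mul_left _)]
    exact ENNReal.ofReal_ne_top
  have hmeas : ∀ n : ℕ, Measurable fun z =>
      ENNReal.ofReal ((M (n ^ 2) z / (n ^ 2 : ℕ)) ^ 2) :=
    fun n => (measurable_of_dependsOn (hdep (n ^ 2))).ennreal_ofReal
  rw [← lintegral_tsum fun n => (hmeas n).aemeasurable] at hsumm
  filter_upwards [ae_lt_top (Measurable.tsum hmeas) hsumm] with z hz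
  have h1 := ENNReal.tendsto_atTop_zero_of_tsum_ne_top hz.ne
  have h2 : Tendsto (fun n : ℕ => |M (n ^ 2) z| / ((n ^ 2 : ℕ) : ℝ)) atTop (𝓝 0) := by
    have h3 := (ENNReal.tendsto_toReal ENNReal.zero_ne_top).comp h1
    have h4 : Tendsto (fun n : ℕ => (M (n ^ 2) z / (n ^ 2 : ℕ)) ^ 2) atTop (𝓝 0) := by
      refine h3.congr fun n => ?_
      simp only [Function.comp_apply]
      exact ENNReal.toReal_ofReal (sq_nonneg _)
    have h5 := h4.sqrt
    rw [Real.sqrt_zero] at h5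
    refine h5.congr fun n => ?_
    rw [Real.sqrt_sq_eq_abs, abs_div, Nat.abs_cast]
  have hsq : Tendsto Nat.sqrt atTop atTop :=
    tendsto_atTop_mono' _ (Eventually.of_forall fun n => le_rfl)
      (tendsto_atTop_atTop.2 fun b => ⟨b ^ 2, fun a ha => Nat.le_sqrt'.2 ha⟩)
  have h6 : Tendsto (fun n : ℕ => 2 * K / (n : ℝ)) atTop (𝓝 0) :=
    tendsto_const_div_atTop_nhds_zero_nat _
  have h7 := (h2.add h6).comp hsq
  rw [add_zero] at h7
  refine squeeze_zero_norm' ?_ h7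
  filter_upwards [eventually_ge_atTop 1] with L hL
  set n := Nat.sqrt L
  have hn1 : 1 ≤ n := Nat.le_sqrt'.2 (by simpa using hL)
  have hn2 : n ^ 2 ≤ L := Nat.sqrt_le' L
  have hn3 : L < (n + 1) ^ 2 := Nat.lt_succ_sqrt' L
  have hn3' : L ≤ n ^ 2 + 2 * n := by nlinarith
  have h8 : |M L z| ≤ |M (n ^ 2) z| + 2 * n * K := by
    have h9 : M L z = M (n ^ 2) z +
        ∑ l ∈ Finset.Ico (n ^ 2) L, d (trajectory f s₀ z l) (z l) :=
      (Finset.sum_range_add_sum_Ico _ hn2).symm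
    rw [h9]
    refine (abs_add_le _ _).trans (add_le_add le_rfl ?_)
    refine (abs_sum_trajectory_le hK z _).trans (mul_le_mul_of_nonneg_right ?_ hK0)
    rw [Nat.card_Ico]
    exact_mod_cast (by omega : L - n ^ 2 ≤ 2 * n)
  have hn0 : (0 : ℝ) < n := by exact_mod_cast hn1
  have hn2' : ((n ^ 2 : ℕ) : ℝ) ≤ L := by exact_mod_cast hn2
  simp only [Function.comp_apply, norm_div, Real.norm_eq_abs, Nat.abs_cast]
  calc |M L z| / L ≤ (|M (n ^ 2) z| + 2 * n * K) / ((n ^ 2 : ℕ) : ℝ) :=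
        div_le_div₀ (by positivity) h8 (by positivity) hn2'
    _ = _ := by
        change _ = |M (n ^ 2) z| / ((n ^ 2 : ℕ) : ℝ) + 2 * K / (n : ℝ)
        push_cast
        field_simp

/-- Strong law of large numbers: the mean reward per step converges to the constant of the Poisson
equation. -/
theorem PoissonEq.ae_tendsto [Fintype Z] [Fintype S] {ν : Measure Z} [IsProbabilityMeasure ν]
    {f : S → Z → S} {g : S → Z → ℝ} {c : ℝ} {h : S → ℝ}
    (hP : PoissonEq (fun z => ν.real {z}) f g c h) (s₀ : S) :
    ∀ᵐ z ∂(Measure.infinitePi fun _ : ℕ => ν), Tendsto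
      (fun L : ℕ => (∑ l ∈ Finset.range L, g (trajectory f s₀ z l) (z l)) / L) atTop (𝓝 c) := by
  have hsum : ∑ z, ν.real {z} = 1 := by
    rw [sum_measureReal_singleton, Finset.coe_univ, probReal_univ]
  have hd : ∀ s, ∑ z, ν.real {z} * (g s z - c + h (f s z) - h s) = 0 := by
    intro s
    have h1 : ∀ z, ν.real {z} * (g s z - c + h (f s z) - h s) =
        ν.real {z} * (g s z + h (f s z)) - ν.real {z} * (c + h s) := fun z => by ring
    simp only [h1, Finset.sum_sub_distrib, hP s, ← Finset.sum_mul, hsum]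
    ring
  filter_upwards [ae_tendsto_sum_trajectory_div ν f s₀ _ hd] with z hz
  have : Nonempty S := ⟨s₀⟩
  obtain ⟨a, ha⟩ := Finite.exists_max fun s => |h s|
  have h1 : Tendsto (fun L : ℕ => (h (trajectory f s₀ z L) - h s₀) / (L : ℝ)) atTop (𝓝 0) := by
    refine squeeze_zero_norm (fun L => ?_)
      (tendsto_const_div_atTop_nhds_zero_nat (|h a| + |h s₀|))
    rw [norm_div, Real.norm_eq_abs, Real.norm_natCast]
    exact div_le_div_of_nonneg_right ((abs_sub _ _).trans (add_le_add (ha _) le_rfl))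
      (Nat.cast_nonneg _)
  have h2 := (hz.sub h1).add_const c
  rw [sub_zero, zero_add] at h2
  refine h2.congr' ?_
  filter_upwards [eventually_ge_atTop 1] with L hL
  have hL0 : (L : ℝ) ≠ 0 := by positivity
  have h3 : ∑ l ∈ Finset.range L, (g (trajectory f s₀ z l) (z l) - c +
      h (f (trajectory f s₀ z l) (z l)) - h (trajectory f s₀ z l)) =
      ∑ l ∈ Finset.range L, g (trajectory f s₀ z l) (z l) - L * c +
        (h (trajectory f s₀ z L) - h s₀) := by
    have h4 := Finset.sum_range_sub (fun l => h (trajectory f s₀ z l)) L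
    simp only [trajectory] at h4
    rw [← h4]
    simp only [Finset.sum_sub_distrib, Finset.sum_add_distrib, Finset.sum_const,
      Finset.card_range, nsmul_eq_mul]
    ring
  rw [h3]
  field_simp
  ring

end StrongLaw

/-! ### The occupancy chain and its flows -/

section Occupancy

variable {r : ℕ}

theorem hasPacket_zero (s : Fin r → ℕ) : HasPacket s 0 :=
  fun i hi => absurd hi (Fin.succ_ne_zero i)

theorem hasPacket_succ {s : Fin r → ℕ} {i : Fin r} : HasPacket s i.succ ↔ 0 < s i :=
  ⟨fun h => h i rfl, fun h k hk => by rwa [Fin.succ_injective r hk]⟩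

theorem moves_last (m s : Fin r → ℕ) (x : Fin (r + 1) → Bool) :
    moves m s x (Fin.last r) = (x (Fin.last r) && decide (HasPacket s (Fin.last r))) := by
  simp [moves]

theorem moves_castSucc (m s : Fin r → ℕ) (x : Fin (r + 1) → Bool) (i : Fin r) :
    moves m s x i.castSucc = (x i.castSucc && decide (HasPacket s i.castSucc) &&
      decide (s i < m i + (moves m s x i.succ).toNat)) := by
  unfold moves
  rw [Fin.reverseInduction_castSucc]

theorem of_moves {m s : Fin r → ℕ} {x : Fin (r + 1) → Bool} {j : Fin (r + 1)}
    (h : moves m s x j = true) : x j = true ∧ HasPacket s j := by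
  induction j using Fin.lastCases with
  | last => simpa [moves_last] using h
  | cast i =>
    simp only [moves_castSucc, Bool.and_eq_true, decide_eq_true_eq] at h
    exact h.1

theorem toNat_moves_succ_le (m s : Fin r → ℕ) (x : Fin (r + 1) → Bool) (i : Fin r) :
    (moves m s x i.succ).toNat ≤ s i := by
  cases h : moves m s x i.succ
  · simp
  · exact hasPacket_succ.1 (of_moves h).2

theorem nextOccupancy_add (m s : Fin r → ℕ) (x : Fin (r + 1) → Bool) (i : Fin r) :
    nextOccupancy m s x i + (moves m s x i.succ).toNat =
      s i + (moves m s x i.castSucc).toNat := by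
  have := toNat_moves_succ_le m s x i
  unfold nextOccupancy
  omega

theorem nextOccupancy_le {m s : Fin r → ℕ} (x : Fin (r + 1) → Bool) {i : Fin r}
    (hs : s i ≤ m i) : nextOccupancy m s x i ≤ m i := by
  have h1 := nextOccupancy_add m s x i
  cases h : moves m s x i.castSucc
  · rw [h] at h1
    simp only [Bool.toNat_false] at h1
    omega
  · have h2 := moves_castSucc m s x i
    rw [h] at h1 h2
    simp only [Bool.true_eq, Bool.and_eq_true, decide_eq_true_eq] at h2
    simp only [Bool.toNat_true] at h1
    omega

/-- The occupancies after one epoch, as a state of the chain. -/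
def occStep (m : Fin r → ℕ) (s : ∀ i, Fin (m i + 1)) (x : Fin (r + 1) → Bool) :
    ∀ i, Fin (m i + 1) :=
  fun i => ⟨nextOccupancy m (fun i => s i) x i,
    Nat.lt_succ_of_le (nextOccupancy_le x (Nat.le_of_lt_succ (s i).2))⟩

theorem occStep_eq_iff {m : Fin r → ℕ} {s s' : ∀ i, Fin (m i + 1)} {x : Fin (r + 1) → Bool} :
    occStep m s x = s' ↔ nextOccupancy m (fun i => s i) x = fun i => (s' i : ℕ) := by
  constructor
  · rintro rfl
    rfl
  · intro h
    funext i
    exact Fin.ext (congrFun h i)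

/-- Occupancies at the beginning of epoch `t`, starting with empty relays. -/
def occupancy (m : Fin r → ℕ) (x : ℕ → Fin (r + 1) → Bool) (t : ℕ) : Fin r → ℕ :=
  fun i => trajectory (occStep m) (fun _ => 0) x t i

/-- Number of packets moved over link `j` in the epochs before `t`, starting with empty relays. -/
def flow (m : Fin r → ℕ) (x : ℕ → Fin (r + 1) → Bool) (j : Fin (r + 1)) (t : ℕ) : ℕ :=
  ∑ l ∈ Finset.range t, (moves m (occupancy m x l) (x l) j).toNat

theorem flow_succ (m : Fin r → ℕ) (x : ℕ → Fin (r + 1) → Bool) (j : Fin (r + 1)) (t : ℕ) :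
    flow m x j (t + 1) = flow m x j t + (moves m (occupancy m x t) (x t) j).toNat :=
  Finset.sum_range_succ _ _

theorem occupancy_succ (m : Fin r → ℕ) (x : ℕ → Fin (r + 1) → Bool) (t : ℕ) :
    occupancy m x (t + 1) = nextOccupancy m (occupancy m x t) (x t) := rfl

theorem occupancy_le (m : Fin r → ℕ) (x : ℕ → Fin (r + 1) → Bool) (t : ℕ) (i : Fin r) :
    occupancy m x t i ≤ m i := Nat.le_of_lt_succ (Fin.is_lt _)

theorem flow_castSucc (m : Fin r → ℕ) (x : ℕ → Fin (r + 1) → Bool) (i : Fin r) (t : ℕ) :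
    flow m x i.castSucc t = occupancy m x t i + flow m x i.succ t := by
  induction t with
  | zero => simp [flow, occupancy, trajectory]
  | succ t ih =>
    rw [flow_succ, flow_succ, occupancy_succ, ih]
    have := nextOccupancy_add m (occupancy m x t) (x t) i
    omega

/-- The flows solve the recursion
`D_j(t+1) = min (D_j(t) + x_j(t)) (D_{j-1}(t)) (D_{j+1}(t+1) + m)`,
without the second term at the first link and without the third at the last. This is stated as an
induction principle: any bound on quantities attached to the links that is
preserved by the three terms of the minimum holds with the flow as its value. -/
theorem flow_induction {m : Fin r → ℕ} {x : ℕ → Fin (r + 1) → Bool}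
    {B : Fin (r + 1) → ℕ → ℕ → Prop} (h0 : ∀ j, B j 0 0)
    (h1 : ∀ j t k, B j t k → B j (t + 1) (k + (x t j).toNat))
    (h2 : ∀ i t k, B (Fin.castSucc i) t k → B (Fin.succ i) (t + 1) k)
    (h3 : ∀ i t k, B (Fin.succ i) (t + 1) k → B (Fin.castSucc i) (t + 1) (k + m i))
    (t : ℕ) (j : Fin (r + 1)) : B j t (flow m x j t) := by
  induction t generalizing j with
  | zero => simpa [flow] using h0 j
  | succ t ih =>
    have key : ∀ j, (moves m (occupancy m x t) (x t) j = x t j) ∨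
        (x t j = true ∧ moves m (occupancy m x t) (x t) j = false) := by
      intro j
      cases h : moves m (occupancy m x t) (x t) j
      · cases hx : x t j <;> simp
      · simp [(of_moves h).1]
    -- An idle link that is not erased either has an empty tail or a full head.
    have hidle : ∀ j, moves m (occupancy m x t) (x t) j = false →
        ¬ HasPacket (occupancy m x t) j → B j (t + 1) (flow m x j (t + 1)) := by
      intro j hj hp
      induction j using Fin.cases with
      | zero => exact absurd (hasPacket_zero _) hp
      | succ i =>
        rw [hasPacket_succ] at hp
        have h4 := flow_castSucc m x i t
        rw [flow_succ, hj, Bool.toNat_false, add_zero,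
          show flow m x i.succ t = flow m x i.castSucc t by omega]
        exact h2 i t _ (ih i.castSucc)
    induction j using Fin.reverseInduction with
    | last =>
      rcases key (Fin.last r) with h | ⟨hx, h⟩
      · rw [flow_succ, h]
        exact h1 _ _ _ (ih _)
      · refine hidle _ h ?_
        rw [moves_last, hx] at h
        simpa using h
    | cast i ihj =>
      rcases key i.castSucc with h | ⟨hx, h⟩
      · rw [flow_succ, h]
        exact h1 _ _ _ (ih _)
      · by_cases hp : HasPacket (occupancy m x t) i.castSucc
        · have h5 := h
          rw [moves_castSucc, hx] at h5
          simp only [hp, decide_true, Bool.and_self, Bool.true_and, decide_eq_false_iff_not,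
            not_lt] at h5
          have h6 := occupancy_le m x t i
          have h7 := flow_castSucc m x i t
          have h8 := flow_succ m x i.succ t
          rw [flow_succ, h, Bool.toNat_false, add_zero,
            show flow m x i.castSucc t = flow m x i.succ (t + 1) + m i by omega]
          exact h3 i t _ ihj
        · exact hidle _ h hp

/-- The empty state is reached from everywhere: moving a packet out of the last nonempty relay
decreases the occupancies lexicographically. -/
theorem reachable_occStep {m : Fin r → ℕ} (hm : ∀ i, 0 < m i) :
    Reachable (occStep m) fun _ => 0 := by
  intro s
  refine wellFounded_lt.induction (C := fun L => Relation.ReflTransGen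
    (fun s t => ∃ z, occStep m s z = t) (ofLex L) fun _ => 0) (toLex s) fun L ih => ?_
  obtain ⟨s, rfl⟩ := toLex.surjective L
  rw [ofLex_toLex]
  by_cases hs : s = fun _ => 0
  · rw [hs]
  · obtain ⟨k, hk⟩ := Function.ne_iff.1 hs
    obtain ⟨i, hi, hmax⟩ := Finset.exists_max_image
      (Finset.univ.filter fun i => s i ≠ 0) id ⟨k, by simpa using hk⟩
    have hi0 : 0 < (s i : ℕ) := by
      simp only [Finset.mem_filter, Finset.mem_univ, true_and] at hi
      exact Nat.pos_of_ne_zero fun h => hi (Fin.ext h)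
    have hlast : ∀ k, i < k → (s k : ℕ) = 0 := fun k hk => by
      by_contra hne
      refine absurd (hmax k ?_) (not_le.2 hk)
      simp only [Finset.mem_filter, Finset.mem_univ, true_and]
      exact fun h => hne (by rw [h]; rfl)
    set x : Fin (r + 1) → Bool := fun j => decide (j = i.succ) with hx
    have hidle : ∀ j, j ≠ i.succ → moves m (fun i => s i) x j = false := fun j hj => by
      by_contra hne
      have := (of_moves (Bool.eq_true_of_not_eq_false hne)).1
      simp [hx, hj] at this
    have hmove : moves m (fun i => s i) x i.succ = true := by
      have hp : HasPacket (fun i => (s i : ℕ)) i.succ := hasPacket_succ.2 hi0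
      rcases Fin.eq_castSucc_or_eq_last i.succ with ⟨k, hk⟩ | hk
      · have hik : i < k := by
          have := congrArg Fin.val hk
          simp only [Fin.val_succ, Fin.val_castSucc] at this
          exact Fin.lt_def.2 (by omega)
        rw [hk] at hp ⊢
        rw [moves_castSucc]
        simp [hlast k hik, hp, hx, hk, hm k]
      · rw [hk] at hp ⊢
        rw [moves_last]
        simp [hp, hx, hk]
    have hci : moves m (fun i => s i) x i.castSucc = false :=
      hidle _ (Fin.castSucc_lt_succ).ne
    refine Relation.ReflTransGen.head ⟨x, rfl⟩ (ih (toLex (occStep m s x)) ?_)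
    refine ⟨i, fun k hk => Fin.ext ?_, ?_⟩
    · have h1 := nextOccupancy_add m (fun i => s i) x k
      rw [hidle k.succ fun h => hk.ne (Fin.succ_injective _ h),
        hidle k.castSucc ((Fin.castSucc_lt_castSucc_iff.2 hk).trans Fin.castSucc_lt_succ).ne]
        at h1
      exact h1
    · have h1 := nextOccupancy_add m (fun i => s i) x i
      rw [hmove, hci] at h1
      change nextOccupancy m (fun i => s i) x i < s i
      simp only [Bool.toNat_true, Bool.toNat_false] at h1
      omega

/-- Reward of the occupancy chain: whether a packet moves over the last link. -/
def delivery (m : Fin r → ℕ) (s : ∀ i, Fin (m i + 1)) (x : Fin (r + 1) → Bool) : ℝ :=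
  (moves m (fun i => s i) x (Fin.last r)).toNat

theorem sum_delivery (m : Fin r → ℕ) (x : ℕ → Fin (r + 1) → Bool) (L : ℕ) :
    ∑ l ∈ Finset.range L, delivery m (trajectory (occStep m) (fun _ => 0) x l) (x l) =
      flow m x (Fin.last r) L := by
  simp only [delivery, flow, Nat.cast_sum]
  rfl

variable (ε : Fin (r + 1) → Set.Ioo (0 : ℝ) 1)

theorem patternProb_pos (x : Fin (r + 1) → Bool) : 0 < patternProb ε x := by
  refine Finset.prod_pos fun j _ => ?_
  have h := (ε j).2
  split_ifs
  · linarith [h.2]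
  · exact h.1

theorem sum_patternProb_mul_toNat (j : Fin (r + 1)) :
    ∑ x, patternProb ε x * ((x j).toNat : ℝ) = 1 - ε j := by
  have h : ∀ x : Fin (r + 1) → Bool, patternProb ε x * ((x j).toNat : ℝ) =
      ∏ k, (if x k then 1 - (ε k : ℝ) else if k = j then 0 else (ε k : ℝ)) := by
    intro x
    cases hx : x j
    · simp only [Bool.toNat_false, Nat.cast_zero, mul_zero]
      exact (Finset.prod_eq_zero (Finset.mem_univ j) (by simp [hx])).symm
    · simp only [Bool.toNat_true, Nat.cast_one, mul_one, patternProb]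
      refine Finset.prod_congr rfl fun k _ => ?_
      by_cases hk : k = j
      · subst hk
        simp [hx]
      · simp [hk]
  simp only [h]
  rw [← Fintype.prod_sum
    (fun k (b : Bool) => if b then 1 - (ε k : ℝ) else if k = j then 0 else (ε k : ℝ))]
  simp only [Fintype.sum_bool, if_true, Bool.false_eq_true, if_false]
  rw [Finset.prod_eq_single j (fun k _ hk => by simp [hk]) (by simp)]
  simp

theorem isStationary_iff {m : Fin r → ℕ} {π : (∀ i, Fin (m i + 1)) → ℝ} :
    IsStationary ε m π ↔ π ∈ stdSimplex ℝ (∀ i, Fin (m i + 1)) ∧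
      ∀ φ : (∀ i, Fin (m i + 1)) → ℝ,
        ∑ s, π s * ∑ x, patternProb ε x * φ (occStep m s x) = ∑ s, π s * φ s := by
  have htr : ∀ s s', transition ε m s s' =
      ∑ x, patternProb ε x * if occStep m s x = s' then 1 else 0 := by
    intro s s'
    refine Finset.sum_congr rfl fun x _ => ?_
    simp only [occStep_eq_iff, mul_ite, mul_one, mul_zero]
  refine and_congr_right fun _ => ⟨fun h φ => ?_, fun h => ?_⟩
  · have h1 : ∑ s', Matrix.vecMul π (transition ε m) s' * φ s' = ∑ s', π s' * φ s' := by rw [h]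
    rw [← h1]
    simp only [Matrix.vecMul, dotProduct, Finset.sum_mul]
    rw [Finset.sum_comm]
    refine Finset.sum_congr rfl fun s _ => ?_
    simp only [mul_assoc, ← Finset.mul_sum, htr, Finset.sum_mul]
    rw [Finset.sum_comm]
    congr 1
    refine Finset.sum_congr rfl fun x _ => ?_
    simp
  · funext s'
    have h1 := h fun s => if s = s' then 1 else 0
    simp only [← htr] at h1
    simpa [Matrix.vecMul, dotProduct] using h1

theorem existsUnique_isStationary {m : Fin r → ℕ} (hm : ∀ i, 0 < m i) :
    ∃! π, IsStationary ε m π := by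
  simp only [isStationary_iff]
  exact existsUnique_stationary (patternProb_pos ε) (sum_patternProb ε) (reachable_occStep hm)

/-- The mean delivery rate is `1 - ε` of the last link times the stationary probability that the
last node has a packet. -/
theorem PoissonEq.eq_throughput {m : Fin r → ℕ} {c : ℝ} {h : (∀ i, Fin (m i + 1)) → ℝ}
    (hP : PoissonEq (patternProb ε) (occStep m) (delivery m) c h)
    {π : (∀ i, Fin (m i + 1)) → ℝ} (hπ : IsStationary ε m π) :
    c = (1 - (ε (Fin.last r) : ℝ)) *
      ∑ s with HasPacket (fun i => (s i : ℕ)) (Fin.last r), π s := by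
  rw [isStationary_iff] at hπ
  rw [hP.eq_sum_stationary hπ.1.2 hπ.2, Finset.sum_filter, Finset.mul_sum]
  refine Finset.sum_congr rfl fun s _ => ?_
  rw [← sum_patternProb_mul_toNat ε (Fin.last r)]
  by_cases hs : HasPacket (fun i => (s i : ℕ)) (Fin.last r)
  · simp [delivery, moves_last, hs, mul_comm]
  · simp [delivery, moves_last, hs]

theorem real_patternPMF_singleton (x : Fin (r + 1) → Bool) :
    (patternPMF ε).toMeasure.real {x} = patternProb ε x := by
  rw [measureReal_def, PMF.toMeasure_apply_singleton _ _ (measurableSet_singleton x)]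
  simp [patternPMF, ENNReal.toReal_ofReal (patternProb_nonneg ε x)]

/-- The flow into the destination grows at the mean delivery rate, almost surely. -/
theorem ae_tendsto_flow_div {m : Fin r → ℕ} {c : ℝ} {h : (∀ i, Fin (m i + 1)) → ℝ}
    (hP : PoissonEq (patternProb ε) (occStep m) (delivery m) c h) :
    ∀ᵐ ξ ∂(channelLaw ε), Tendsto
      (fun L : ℕ => (flow m ξ (Fin.last r) L : ℝ) / L) atTop (𝓝 c) := by
  have hP' : PoissonEq (fun x => (patternPMF ε).toMeasure.real {x}) (occStep m) (delivery m) c h :=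
    by simpa only [real_patternPMF_singleton] using hP
  filter_upwards [hP'.ae_tendsto fun _ => 0] with ξ hξ
  simpa only [sum_delivery] using hξ

end Occupancy

/-! ### Locality in time -/

section Locality

variable {r : ℕ} {m : Fin r → ℕ}

theorem occupancy_congr {x x' : ℕ → Fin (r + 1) → Bool} {t : ℕ} (h : ∀ l < t, x l = x' l) :
    occupancy m x t = occupancy m x' t := by
  have h1 : trajectory (occStep m) (fun _ => 0) x t = trajectory (occStep m) (fun _ => 0) x' t :=
    dependsOn_trajectory (occStep m) (fun _ => 0) t fun l hl => h l (by simpa using hl)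
  unfold occupancy
  rw [h1]

theorem flow_congr {x x' : ℕ → Fin (r + 1) → Bool} {t : ℕ} (h : ∀ l < t, x l = x' l)
    (j : Fin (r + 1)) : flow m x j t = flow m x' j t := by
  refine Finset.sum_congr rfl fun l hl => ?_
  rw [Finset.mem_range] at hl
  rw [h l hl, occupancy_congr fun k hk => h k (hk.trans hl)]

theorem history_congr {x x' : ℕ → Fin (r + 1) → Bool} {t : ℕ} (h : ∀ l < t, x l = x' l) :
    history x t = history x' t :=
  List.map_congr_left fun l hl => h l (List.mem_range.1 hl)

variable {A W : Type*}

theorem FeedbackCode.buffers_congr (c : FeedbackCode m A W) (w : W)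
    {x x' : ℕ → Fin (r + 1) → Bool} {t : ℕ} (h : ∀ l < t, x l = x' l) :
    c.buffers w x t = c.buffers w x' t := by
  induction t with
  | zero => rfl
  | succ t ih =>
    have h0 : ∀ l < t, x l = x' l := fun l hl => h l (by omega)
    funext i
    simp only [FeedbackCode.buffers, FeedbackCode.sent, ih h0, history_congr h, history_congr h0,
      h t (by omega)]

theorem FeedbackCode.received_congr (c : FeedbackCode m A W) (w : W)
    {x x' : ℕ → Fin (r + 1) → Bool} {t : ℕ} (h : ∀ l < t + 1, x l = x' l) :
    c.received w x t = c.received w x' t := by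
  have h0 : ∀ l < t, x l = x' l := fun l hl => h l (by omega)
  simp only [FeedbackCode.received, FeedbackCode.sent, c.buffers_congr w h0, history_congr h0,
    h t (by omega)]

theorem FeedbackCode.dependsOn_output (c : FeedbackCode m A W) (w : W) (L : ℕ) :
    DependsOn (fun ξ => c.output w ξ L) (Finset.range L : Set ℕ) := by
  intro x x' h
  have h' : ∀ l < L, x l = x' l := fun l hl => h l (by simpa using hl)
  have h1 : (List.range L).map (c.received w x) = (List.range L).map (c.received w x') :=
    List.map_congr_left fun l hl => c.received_congr w fun k hk =>
      h' k (by rw [List.mem_range] at hl; omega)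
  simp only [FeedbackCode.output, h1, history_congr h']

theorem measurableSet_output (c : FeedbackCode m A W) (w : W) (L : ℕ) :
    MeasurableSet {ξ | c.output w ξ L = w} := by
  have : DependsOn (fun ξ => c.output w ξ L = w) (Finset.range L : Set ℕ) := fun x x' h => by
    simp only [c.dependsOn_output w L h]
  exact measurableSet_setOfPred.2 (measurable_of_dependsOn this)

theorem measurable_flow (j : Fin (r + 1)) (t : ℕ) :
    Measurable fun ξ : ℕ → Fin (r + 1) → Bool => flow m ξ j t :=
  measurable_of_dependsOn (L := t) fun _ _ h => flow_congr (fun l hl => h l (by simpa using hl)) j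

end Locality

/-! ### The converse: what lies behind a link is described by as many packets as its flow -/

section Converse

variable {r : ℕ} {m : Fin r → ℕ} {A W : Type*}

/-- At the beginning of epoch `t`, the relays and the destination behind link `j` cannot tell the
messages `w` and `w'` apart. -/
def Indist (c : FeedbackCode m A W) (ξ : ℕ → Fin (r + 1) → Bool) (j : Fin (r + 1)) (t : ℕ)
    (w w' : W) : Prop :=
  (∀ i : Fin r, j ≤ i.castSucc → c.buffers w ξ t i = c.buffers w' ξ t i) ∧
    ∀ l < t, c.received w ξ l = c.received w' ξ l

theorem Indist.sent_eq {c : FeedbackCode m A W} {ξ : ℕ → Fin (r + 1) → Bool} {j k : Fin (r + 1)}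
    {t : ℕ} {w w' : W} (h : Indist c ξ j t w w') (hjk : j < k) :
    c.sent w ξ t (c.buffers w ξ t) k = c.sent w' ξ t (c.buffers w' ξ t) k := by
  induction k using Fin.cases with
  | zero => exact absurd hjk (Fin.not_lt_zero _)
  | succ i => simp [FeedbackCode.sent, h.1 i (Fin.le_castSucc_iff.2 hjk)]

theorem Indist.succ {c : FeedbackCode m A W} {ξ : ℕ → Fin (r + 1) → Bool} {j : Fin (r + 1)}
    {t : ℕ} {w w' : W} (h : Indist c ξ j t w w')
    (hj : ξ t j = true → c.sent w ξ t (c.buffers w ξ t) j = c.sent w' ξ t (c.buffers w' ξ t) j) :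
    Indist c ξ j (t + 1) w w' := by
  have hs : ∀ k, j ≤ k → (if ξ t k then some (c.sent w ξ t (c.buffers w ξ t) k) else none) =
      if ξ t k then some (c.sent w' ξ t (c.buffers w' ξ t) k) else none := by
    intro k hk
    split_ifs with hx
    · rcases hk.eq_or_lt with rfl | hk
      · rw [hj hx]
      · rw [h.sent_eq hk]
    · rfl
  refine ⟨fun i hi => ?_, fun l hl => ?_⟩
  · simp only [FeedbackCode.buffers, hs _ hi, h.1 i hi]
  · rcases Nat.lt_succ_iff_lt_or_eq.1 hl with hl | rfl
    · exact h.2 l hl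
    · exact hs _ (Fin.le_last _)

/-- Everything behind link `j` is a function of `flow m ξ j t` packets. -/
theorem exists_description (c : FeedbackCode m A W) (ξ : ℕ → Fin (r + 1) → Bool) (t : ℕ)
    (j : Fin (r + 1)) :
    ∃ Φ : W → Fin (flow m ξ j t) → A, ∀ w w', Φ w = Φ w' → Indist c ξ j t w w' := by
  refine flow_induction
    (B := fun j t k => ∃ Φ : W → Fin k → A, ∀ w w', Φ w = Φ w' → Indist c ξ j t w w')
    (fun j => ?_) (fun j t k => ?_) (fun i t k => ?_) (fun i t k => ?_) t j
  · exact ⟨fun _ k => k.elim0, fun w w' _ => ⟨fun i _ => rfl, fun l hl => absurd hl (by omega)⟩⟩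
  · rintro ⟨Φ, hΦ⟩
    cases hx : ξ t j
    · exact ⟨Φ, fun w w' h => (hΦ w w' h).succ fun h' => by simp [hx] at h'⟩
    · refine ⟨fun w => Fin.snoc (α := fun _ => A) (Φ w) (c.sent w ξ t (c.buffers w ξ t) j),
        fun w w' h => ?_⟩
      have h' := Fin.snoc_inj.1 h
      exact (hΦ w w' h'.1).succ fun _ => h'.2
  · rintro ⟨Φ, hΦ⟩
    refine ⟨Φ, fun w w' h => ?_⟩
    have h1 := hΦ w w' h
    have h2 : Indist c ξ i.succ t w w' :=
      ⟨fun k hk => h1.1 k (Fin.castSucc_lt_succ.le.trans hk), h1.2⟩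
    exact h2.succ fun _ => h1.sent_eq Fin.castSucc_lt_succ
  · rintro ⟨Φ, hΦ⟩
    refine ⟨fun w => Fin.append (Φ w) (c.buffers w ξ (t + 1) i), fun w w' h => ?_⟩
    have e1 : Φ w = Φ w' := funext fun a => by
      simpa using congrFun h (Fin.castAdd (m i) a)
    have e2 : c.buffers w ξ (t + 1) i = c.buffers w' ξ (t + 1) i := funext fun a => by
      simpa using congrFun h (Fin.natAdd k a)
    refine ⟨fun k hk => ?_, (hΦ w w' e1).2⟩
    rcases hk.eq_or_lt with hk | hk
    · rw [← Fin.castSucc_injective _ hk]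
      exact e2
    · exact (hΦ w w' e1).1 k (Fin.succ_le_castSucc_iff.2 (Fin.castSucc_lt_castSucc_iff.1 hk))

/-- Messages that are decoded correctly have different descriptions. -/
theorem card_correct_le [Fintype A] [Fintype W] [DecidableEq W] (c : FeedbackCode m A W)
    (ξ : ℕ → Fin (r + 1) → Bool) (L : ℕ) :
    (Finset.univ.filter fun w => c.output w ξ L = w).card ≤
      Fintype.card A ^ flow m ξ (Fin.last r) L := by
  classical
  obtain ⟨Φ, hΦ⟩ := exists_description c ξ L (Fin.last r)
  have h1 : (Fintype.card A) ^ flow m ξ (Fin.last r) L =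
      (Finset.univ : Finset (Fin (flow m ξ (Fin.last r) L) → A)).card := by simp
  rw [h1]
  refine Finset.card_le_card_of_injOn Φ (fun _ _ => Finset.mem_coe.2 (Finset.mem_univ _)) ?_
  intro w hw w' hw' h
  simp only [Finset.coe_filter, Finset.mem_univ, true_and, Set.mem_ofPred_eq] at hw hw'
  have h2 : (List.range L).map (c.received w ξ) = (List.range L).map (c.received w' ξ) :=
    List.map_congr_left fun l hl => (hΦ w w' h).2 l (List.mem_range.1 hl)
  have h3 : c.output w ξ L = c.output w' ξ L := by simp only [FeedbackCode.output, h2]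
  rw [← hw, h3, hw']

theorem sum_measureReal_le_of_card_le {Ω : Type*} [MeasurableSpace Ω] {P : Measure Ω}
    [IsProbabilityMeasure P] [Fintype W] {E : W → Set Ω} (hE : ∀ w, MeasurableSet (E w)) {N : ℝ}
    (hN : ∀ ω, ∑ w, (E w).indicator (fun _ => (1 : ℝ)) ω ≤ N) : ∑ w, P.real (E w) ≤ N := by
  have h1 : ∀ w, P.real (E w) = ∫ ω, (E w).indicator (fun _ => (1 : ℝ)) ω ∂P := fun w => by
    rw [integral_indicator_const _ (hE w)]
    simp
  simp only [h1]
  rw [← integral_finsetSum _ fun w _ => (integrable_const _).indicator (hE w)]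
  calc _ ≤ ∫ _, N ∂P := integral_mono
        (integrable_finsetSum _ fun w _ => (integrable_const _).indicator (hE w))
        (integrable_const _) hN
    _ = N := by simp

instance {r : ℕ} (ε : Fin (r + 1) → Set.Ioo (0 : ℝ) 1) : IsProbabilityMeasure (channelLaw ε) :=
  inferInstanceAs (IsProbabilityMeasure (Measure.infinitePi fun _ => (patternPMF ε).toMeasure))

/-- A code with `M` messages fails unless the flow into the destination is at least about
`log M`. -/
theorem one_sub_le_errorProb [Fintype A] [Nonempty A] (ε : Fin (r + 1) → Set.Ioo (0 : ℝ) 1)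
    {M : ℕ} (hM : 0 < M) (c : FeedbackCode m A (Fin M)) (L : ℕ) (b : ℝ) :
    1 - (channelLaw ε).real {ξ | b ≤ flow m ξ (Fin.last r) L} - (Fintype.card A : ℝ) ^ b / M ≤
      c.errorProb ε L := by
  set P := channelLaw ε
  set G : Set (ℕ → Fin (r + 1) → Bool) := {ξ | b ≤ flow m ξ (Fin.last r) L}
  have hG : MeasurableSet G :=
    measurableSet_le measurable_const (measurable_from_nat.comp (measurable_flow (Fin.last r) L))
  have hM0 : (0 : ℝ) < M := by exact_mod_cast hM
  have hA : (1 : ℝ) ≤ Fintype.card A := by exact_mod_cast Fintype.card_pos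
  have h1 : ∑ w, P.real ({ξ | c.output w ξ L = w} \ G) ≤ (Fintype.card A : ℝ) ^ b := by
    refine sum_measureReal_le_of_card_le (fun w => (measurableSet_output c w L).diff hG) fun ξ => ?_
    by_cases hξ : ξ ∈ G
    · rw [Finset.sum_eq_zero fun w _ => Set.indicator_of_notMem (fun h => h.2 hξ) _]
      positivity
    · have h2 : ∑ w, ({ξ | c.output w ξ L = w} \ G).indicator (fun _ => (1 : ℝ)) ξ =
          ((Finset.univ.filter fun w => c.output w ξ L = w).card : ℝ) := by
        rw [Finset.card_filter]
        push_cast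
        refine Finset.sum_congr rfl fun w _ => ?_
        simp [Set.indicator_apply, hξ]
      rw [h2]
      have h3 : (flow m ξ (Fin.last r) L : ℝ) ≤ b := (not_le.1 hξ).le
      calc _ ≤ ((Fintype.card A ^ flow m ξ (Fin.last r) L : ℕ) : ℝ) :=
            Nat.cast_le.2 (card_correct_le c ξ L)
        _ = (Fintype.card A : ℝ) ^ (flow m ξ (Fin.last r) L : ℝ) := by
            rw [Real.rpow_natCast]
            push_cast
            rfl
        _ ≤ _ := Real.rpow_le_rpow_of_exponent_le hA h3
  have h4 : ∀ w, 1 - P.real G - P.real ({ξ | c.output w ξ L = w} \ G) ≤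
      P.real {ξ | c.output w ξ L ≠ w} := by
    intro w
    have h5 : (Set.univ : Set (ℕ → Fin (r + 1) → Bool)) ⊆
        (G ∪ ({ξ | c.output w ξ L = w} \ G)) ∪ {ξ | c.output w ξ L ≠ w} := by
      intro ξ _
      by_cases h6 : ξ ∈ G
      · exact Or.inl (Or.inl h6)
      · by_cases h7 : c.output w ξ L = w
        · exact Or.inl (Or.inr ⟨h7, h6⟩)
        · exact Or.inr h7
    have h6 : P.real Set.univ ≤ _ := measureReal_mono h5
    rw [probReal_univ] at h6
    have h7 := measureReal_union_le (μ := P) (G ∪ ({ξ | c.output w ξ L = w} \ G))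
      {ξ | c.output w ξ L ≠ w}
    have h8 := measureReal_union_le (μ := P) G ({ξ | c.output w ξ L = w} \ G)
    linarith
  have h9 := Finset.sum_le_sum fun w (_ : w ∈ Finset.univ) => h4 w
  rw [Finset.sum_sub_distrib, Finset.sum_const, Finset.card_univ, Fintype.card_fin,
    nsmul_eq_mul] at h9
  unfold FeedbackCode.errorProb
  rw [Fintype.card_fin, le_div_iff₀ hM0, sub_mul, div_mul_cancel₀ _ hM0.ne']
  linarith

/-- The flow concentrates around its mean rate. -/
theorem tendsto_measureReal_flow (ε : Fin (r + 1) → Set.Ioo (0 : ℝ) 1) {C : ℝ}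
    (hC : ∀ᵐ ξ ∂(channelLaw ε), Tendsto
      (fun L : ℕ => (flow m ξ (Fin.last r) L : ℝ) / L) atTop (𝓝 C)) {η : ℝ} (hη : 0 < η) :
    Tendsto (fun L : ℕ => (channelLaw ε).real
      {ξ | η ≤ |(flow m ξ (Fin.last r) L : ℝ) / L - C|}) atTop (𝓝 0) := by
  have h1 : TendstoInMeasure (channelLaw ε)
      (fun (L : ℕ) ξ => (flow m ξ (Fin.last r) L : ℝ) / L) atTop fun _ => C :=
    tendstoInMeasure_of_tendsto_ae (fun L => ((measurable_from_nat.comp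
      (measurable_flow (Fin.last r) L)).div_const _).aestronglyMeasurable) hC
  rw [tendstoInMeasure_iff_norm] at h1
  have h2 := (ENNReal.tendsto_toReal ENNReal.zero_ne_top).comp (h1 η hη)
  simp only [Real.norm_eq_abs, ENNReal.toReal_zero] at h2
  exact h2

theorem le_of_achievable [Fintype A] [Nontrivial A] (ε : Fin (r + 1) → Set.Ioo (0 : ℝ) 1) {C : ℝ}
    (hC : ∀ᵐ ξ ∂(channelLaw ε), Tendsto
      (fun L : ℕ => (flow m ξ (Fin.last r) L : ℝ) / L) atTop (𝓝 C)) {R : ℝ}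
    (hR : Achievable A ε m R) : R ≤ C := by
  by_contra! hlt
  set θ := (C + R) / 2 with hθ
  have hA : (1 : ℝ) < Fintype.card A := by exact_mod_cast Fintype.one_lt_card
  have h1 := tendsto_measureReal_flow ε hC (η := θ - C) (by linarith)
  have h2 : Tendsto (fun L : ℕ => ((Fintype.card A : ℝ) ^ (θ - R)) ^ L) atTop (𝓝 0) :=
    tendsto_pow_atTop_nhds_zero_of_lt_one (by positivity)
      (Real.rpow_lt_one_of_one_lt_of_neg hA (by linarith))
  obtain ⟨L, ⟨M, hM, c, hc⟩, hL1, hL2, hL0⟩ := ((hR (1 / 4) (by norm_num)).and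
    ((h1.eventually_lt_const (show (0 : ℝ) < 1 / 4 by norm_num)).and
      ((h2.eventually_lt_const (show (0 : ℝ) < 1 / 4 by norm_num)).and
        (eventually_gt_atTop 0)))).exists
  have hL0' : (0 : ℝ) < L := by exact_mod_cast hL0
  have hM0 : (0 : ℝ) < M := lt_of_lt_of_le (by positivity) hM
  have h3 := one_sub_le_errorProb ε (by exact_mod_cast hM0) c L (θ * L)
  have h4 : (channelLaw ε).real {ξ | θ * L ≤ flow m ξ (Fin.last r) L} ≤
      (channelLaw ε).real {ξ | θ - C ≤ |(flow m ξ (Fin.last r) L : ℝ) / L - C|} := by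
    refine measureReal_mono fun ξ hξ => ?_
    have : θ ≤ (flow m ξ (Fin.last r) L : ℝ) / L := (le_div_iff₀ hL0').2 hξ
    exact (sub_le_sub_right this C).trans (le_abs_self _)
  have h5 : (Fintype.card A : ℝ) ^ (θ * L) / M ≤ ((Fintype.card A : ℝ) ^ (θ - R)) ^ L := by
    rw [div_le_iff₀ hM0, ← Real.rpow_natCast, ← Real.rpow_mul (by positivity)]
    calc (Fintype.card A : ℝ) ^ (θ * L) =
          (Fintype.card A : ℝ) ^ ((θ - R) * L) * (Fintype.card A : ℝ) ^ (R * L) := by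
          rw [← Real.rpow_add (by positivity)]
          ring_nf
      _ ≤ _ := mul_le_mul_of_nonneg_left hM (by positivity)
  linarith

end Converse

/-! ### Achievability: hop-by-hop forwarding -/

section Achievability

variable {r : ℕ} {m : Fin r → ℕ} {A W : Type*}

/-- A history, continued by epochs in which everything is erased. -/
def extend (H : List (Fin (r + 1) → Bool)) : ℕ → Fin (r + 1) → Bool :=
  fun l => H.getD l fun _ => false

theorem extend_history (ξ : ℕ → Fin (r + 1) → Bool) (t : ℕ) :
    ∀ l < t, extend (history ξ t) l = ξ l := by
  intro l hl
  simp [extend, history, hl]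

theorem length_history (ξ : ℕ → Fin (r + 1) → Bool) (t : ℕ) : (history ξ t).length = t := by
  simp [history]

/-- Hop-by-hop forwarding. A message `w` stands for the packets `pk w 0, pk w 1, …`, which travel in
order and move exactly as in the occupancy chain. A relay with `m` slots stores packet number `p` in
slot `p % m`; as all nodes know the erasures, they know which packet is where. The destination
decides on a message that is consistent with the packets that moved. -/
def forwarding [Nonempty W] (hm : ∀ i, 0 < m i) (pk : W → ℕ → A) (a₀ : A) : FeedbackCode m A W where
  init _ _ := a₀
  source w H := pk w (flow m (extend H) 0 H.length)
  relay i H B := B ⟨flow m (extend H) i.succ H.length % m i, Nat.mod_lt _ (hm i)⟩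
  update i H B p :=
    let t := H.length - 1
    if moves m (occupancy m (extend H) t) (extend H t) i.castSucc then
      Function.update B ⟨flow m (extend H) i.castSucc t % m i, Nat.mod_lt _ (hm i)⟩ (p.getD a₀)
    else B
  decode H received := Classical.epsilon fun w => ∀ l < H.length,
    moves m (occupancy m (extend H) l) (extend H l) (Fin.last r) = true →
      received[l]? = some (some (pk w (flow m (extend H) (Fin.last r) l)))

variable [Nonempty W] {hm : ∀ i, 0 < m i} {pk : W → ℕ → A} {a₀ : A} {w : W}
  {ξ : ℕ → Fin (r + 1) → Bool}

theorem forwarding_update (i : Fin r) (H : List (Fin (r + 1) → Bool)) (B : Fin (m i) → A)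
    (p : Option A) : (forwarding hm pk a₀).update i H B p =
      if moves m (occupancy m (extend H) (H.length - 1)) (extend H (H.length - 1)) i.castSucc then
        Function.update B ⟨flow m (extend H) i.castSucc (H.length - 1) % m i, Nat.mod_lt _ (hm i)⟩
          (p.getD a₀)
      else B := rfl

theorem forwarding_decode (H : List (Fin (r + 1) → Bool)) (received : List (Option A)) :
    (forwarding hm pk a₀).decode H received = Classical.epsilon fun w => ∀ l < H.length,
      moves m (occupancy m (extend H) l) (extend H l) (Fin.last r) = true →
        received[l]? = some (some (pk w (flow m (extend H) (Fin.last r) l))) := rfl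

/-- If every relay holds the packets between its two flows, each in its slot, then a link whose tail
has a packet carries the packet whose number is the flow. -/
theorem forwarding_sent {t : ℕ}
    (h : ∀ i, ∀ p, flow m ξ (Fin.succ i) t ≤ p → p < flow m ξ (Fin.castSucc i) t →
      (forwarding hm pk a₀).buffers w ξ t i ⟨p % m i, Nat.mod_lt _ (hm i)⟩ = pk w p)
    {j : Fin (r + 1)} (hj : HasPacket (occupancy m ξ t) j) :
    (forwarding hm pk a₀).sent w ξ t ((forwarding hm pk a₀).buffers w ξ t) j =
      pk w (flow m ξ j t) := by
  have hext := extend_history ξ t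
  induction j using Fin.cases with
  | zero =>
    simp only [FeedbackCode.sent, Fin.cases_zero]
    simp only [forwarding, length_history, flow_congr hext]
  | succ i =>
    have h1 := h i (flow m ξ i.succ t) le_rfl
      (by rw [flow_castSucc]; have := hasPacket_succ.1 hj; omega)
    rw [← h1]
    simp only [FeedbackCode.sent, Fin.cases_succ]
    simp only [forwarding, length_history, flow_congr hext]

theorem forwarding_buffers (t : ℕ) (i : Fin r) (p : ℕ) (hp : flow m ξ i.succ t ≤ p)
    (hp' : p < flow m ξ i.castSucc t) :
    (forwarding hm pk a₀).buffers w ξ t i ⟨p % m i, Nat.mod_lt _ (hm i)⟩ = pk w p := by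
  induction t generalizing i p with
  | zero => simp [flow] at hp'
  | succ t ih =>
    have hext := extend_history ξ (t + 1)
    have hext' : ∀ l < t, extend (history ξ (t + 1)) l = ξ l := fun l hl => hext l (by omega)
    have hstep : (forwarding hm pk a₀).buffers w ξ (t + 1) i =
        if moves m (occupancy m ξ t) (ξ t) i.castSucc then
          Function.update ((forwarding hm pk a₀).buffers w ξ t i)
            ⟨flow m ξ i.castSucc t % m i, Nat.mod_lt _ (hm i)⟩
            (Option.getD (if ξ t i.castSucc then some ((forwarding hm pk a₀).sent w ξ t
              ((forwarding hm pk a₀).buffers w ξ t) i.castSucc) else none) a₀)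
        else (forwarding hm pk a₀).buffers w ξ t i := by
      change (forwarding hm pk a₀).update i (history ξ (t + 1)) _ _ = _
      simp only [forwarding_update, length_history, Nat.add_sub_cancel, occupancy_congr hext',
        flow_congr hext', hext t (by omega)]
    have h1 := flow_succ m ξ i.succ t
    have h2 := flow_succ m ξ i.castSucc t
    cases hmv : moves m (occupancy m ξ t) (ξ t) i.castSucc
    · rw [hmv, Bool.toNat_false] at h2
      rw [hstep, hmv]
      exact ih i p (by omega) (by omega)
    · rw [hmv, Bool.toNat_true] at h2
      obtain ⟨hx, hpk⟩ := of_moves hmv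
      rw [hstep, hmv, if_pos rfl, hx, if_pos rfl, forwarding_sent (fun i p => ih i p) hpk]
      rcases Nat.lt_succ_iff_lt_or_eq.1 (h2 ▸ hp') with hlt | rfl
      · rw [Function.update_of_ne, ih i p (by omega) hlt]
        -- The packets held differ by less than `m i`, so their slots are different.
        intro heq
        have h3 : p % m i = flow m ξ i.castSucc t % m i := congrArg Fin.val heq
        have h4 := Nat.sub_mod_eq_zero_of_mod_eq h3.symm
        have h5 := flow_castSucc m ξ i (t + 1)
        have h6 := occupancy_le m ξ (t + 1) i
        have h7 := Nat.le_of_dvd (by omega) (Nat.dvd_of_mod_eq_zero h4)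
        omega
      · rw [Function.update_self]
        rfl

theorem forwarding_received {t : ℕ}
    (h : moves m (occupancy m ξ t) (ξ t) (Fin.last r) = true) :
    (forwarding hm pk a₀).received w ξ t = some (pk w (flow m ξ (Fin.last r) t)) := by
  obtain ⟨hx, hp⟩ := of_moves h
  rw [FeedbackCode.received, if_pos hx, forwarding_sent (forwarding_buffers t) hp]

/-- Every value below the flow is the flow at some epoch in which a packet moves. -/
theorem exists_moves_of_lt_flow {j : Fin (r + 1)} {p t : ℕ} (h : p < flow m ξ j t) :
    ∃ l < t, moves m (occupancy m ξ l) (ξ l) j = true ∧ flow m ξ j l = p := by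
  induction t with
  | zero => simp [flow] at h
  | succ t ih =>
    by_cases h1 : p < flow m ξ j t
    · obtain ⟨l, hl, h2⟩ := ih h1
      exact ⟨l, by omega, h2⟩
    · rw [flow_succ] at h
      refine ⟨t, by omega, ?_⟩
      cases hmv : moves m (occupancy m ξ t) (ξ t) j
      · rw [hmv, Bool.toNat_false] at h
        omega
      · rw [hmv, Bool.toNat_true] at h
        exact ⟨rfl, by omega⟩

/-- Forwarding succeeds as soon as the packets that determine the message are delivered. -/
theorem forwarding_output {k L : ℕ} (hpk : ∀ w w', (∀ p < k, pk w p = pk w' p) → w = w')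
    (hk : k ≤ flow m ξ (Fin.last r) L) : (forwarding hm pk a₀).output w ξ L = w := by
  have hext := extend_history ξ L
  have hrec : ∀ l < L, ((List.range L).map ((forwarding hm pk a₀).received w ξ))[l]? =
      some ((forwarding hm pk a₀).received w ξ l) := fun l hl => by simp [hl]
  set Q : W → Prop := fun w' => ∀ l < L,
    moves m (occupancy m ξ l) (ξ l) (Fin.last r) = true →
      ((List.range L).map ((forwarding hm pk a₀).received w ξ))[l]? =
        some (some (pk w' (flow m ξ (Fin.last r) l))) with hQ
  have hout : (forwarding hm pk a₀).output w ξ L = Classical.epsilon Q := by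
    rw [FeedbackCode.output, forwarding_decode, length_history]
    congr 1
    funext w'
    refine propext (forall₂_congr fun l hl => ?_)
    have h1 : ∀ l' < l, extend (history ξ L) l' = ξ l' := fun l' hl' => hext l' (by omega)
    rw [occupancy_congr h1, flow_congr h1, hext l hl]
  have hw : Q w := fun l hl hmv => by rw [hrec l hl, forwarding_received hmv]
  rw [hout]
  refine hpk _ _ fun p hp => ?_
  obtain ⟨l, hl, hmv, rfl⟩ := exists_moves_of_lt_flow (hp.trans_le hk)
  have h1 := Classical.epsilon_spec (p := Q) ⟨w, hw⟩ l hl hmv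
  rw [hw l hl hmv] at h1
  simpa using h1.symm

theorem errorProb_le_of_forall_output [Fintype W] (ε : Fin (r + 1) → Set.Ioo (0 : ℝ) 1)
    (c : FeedbackCode m A W) {L k : ℕ}
    (hc : ∀ w ξ, k ≤ flow m ξ (Fin.last r) L → c.output w ξ L = w) :
    c.errorProb ε L ≤ (channelLaw ε).real {ξ | flow m ξ (Fin.last r) L < k} := by
  have hW : (0 : ℝ) < Fintype.card W := by exact_mod_cast Fintype.card_pos
  unfold FeedbackCode.errorProb
  rw [div_le_iff₀ hW]
  have h1 : ∀ w : W, (channelLaw ε).real {ξ | c.output w ξ L ≠ w} ≤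
      (channelLaw ε).real {ξ | flow m ξ (Fin.last r) L < k} := fun w =>
    measureReal_mono fun ξ hξ => not_le.1 fun h => hξ (hc w ξ h)
  refine (Finset.sum_le_card_nsmul _ _ _ fun w _ => h1 w).trans ?_
  rw [nsmul_eq_mul, Finset.card_univ, mul_comm]

end Achievability

variable {r : ℕ} {m : Fin r → ℕ} {A : Type*}

theorem achievable_of_lt [Fintype A] [Nontrivial A] (hm : ∀ i, 0 < m i)
    (ε : Fin (r + 1) → Set.Ioo (0 : ℝ) 1) {C : ℝ}
    (hC : ∀ᵐ ξ ∂(channelLaw ε), Tendsto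
      (fun L : ℕ => (flow m ξ (Fin.last r) L : ℝ) / L) atTop (𝓝 C)) {R : ℝ}
    (hR : R < C) : Achievable A ε m R := by
  intro δ hδ
  have hA : (1 : ℝ) < Fintype.card A := by exact_mod_cast Fintype.one_lt_card
  obtain ⟨θ, hθ1, hθ2⟩ := exists_between hR
  have h1 := tendsto_measureReal_flow ε hC (η := C - θ) (by linarith)
  have h2 : ∀ᶠ L : ℕ in atTop, R * L + 1 ≤ θ * L := by
    have h3 := tendsto_natCast_atTop_atTop (R := ℝ)
    filter_upwards [h3.eventually_ge_atTop (1 / (θ - R))] with L hL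
    rw [div_le_iff₀ (by linarith)] at hL
    linarith
  filter_upwards [h1.eventually_lt_const hδ, h2, eventually_gt_atTop 0] with L hL1 hL2 hL0
  have hL0' : (0 : ℝ) < L := by exact_mod_cast hL0
  set k := ⌈R * L⌉₊
  let e : Fin (Fintype.card A ^ k) ≃ (Fin k → A) :=
    (Fintype.equivFinOfCardEq (by simp)).symm
  obtain ⟨a₀⟩ : Nonempty A := inferInstance
  have : Nonempty (Fin (Fintype.card A ^ k)) := ⟨e.symm fun _ => a₀⟩
  refine ⟨Fintype.card A ^ k, ?_,
    forwarding hm (fun w p => if h : p < k then e w ⟨p, h⟩ else a₀) a₀, ?_⟩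
  · push_cast
    rw [← Real.rpow_natCast]
    exact Real.rpow_le_rpow_of_exponent_le hA.le (Nat.le_ceil _)
  · refine (errorProb_le_of_forall_output ε _ (k := k) fun w ξ hk =>
      forwarding_output (fun w w' h => ?_) hk).trans (le_trans (measureReal_mono ?_) hL1.le)
    · refine e.injective (funext fun p => ?_)
      simpa using h p p.2
    · intro ξ hξ
      have h3 : (flow m ξ (Fin.last r) L : ℝ) < R * L + 1 := by
        rcases le_or_gt 0 (R * L) with h4 | h4
        · exact lt_trans (Nat.cast_lt.2 hξ) (Nat.ceil_lt_add_one h4)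
        · have h5 : k = 0 := Nat.ceil_eq_zero.2 h4.le
          rw [Set.mem_ofPred_eq, h5] at hξ
          exact absurd hξ (Nat.not_lt_zero _)
      have h4 : (flow m ξ (Fin.last r) L : ℝ) / L ≤ θ := by
        rw [div_le_iff₀ hL0']
        linarith
      change C - θ ≤ |_|
      rw [abs_sub_comm]
      exact (sub_le_sub_left h4 C).trans (le_abs_self _)

/-- The capacity with perfect feedback is the rate of the flow into the destination. -/
theorem feedbackCapacity_eq [Fintype A] [Nontrivial A] (hm : ∀ i, 0 < m i)
    (ε : Fin (r + 1) → Set.Ioo (0 : ℝ) 1) {C : ℝ}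
    (hC : ∀ᵐ ξ ∂(channelLaw ε), Tendsto
      (fun L : ℕ => (flow m ξ (Fin.last r) L : ℝ) / L) atTop (𝓝 C)) :
    feedbackCapacity A ε m = C := by
  refine IsLUB.csSup_eq ⟨fun R hR => le_of_achievable ε hC hR, fun b hb => ?_⟩
    ⟨C - 1, achievable_of_lt hm ε hC (by linarith)⟩
  by_contra! hlt
  obtain ⟨R, hR1, hR2⟩ := exists_between hlt
  exact absurd (hb (achievable_of_lt hm ε hC hR2)) (not_le.2 hR1)

/-! ### One epoch of linear network coding -/

section CodingStep

variable {r : ℕ} {m : Fin r → ℕ} {F V V' : Type*} [Field F] [AddCommGroup V] [Module F V]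
  [AddCommGroup V'] [Module F V']

/-- Buffer contents after an epoch that starts with the buffers `B` and the source packet `p`. -/
def stepBuffers (z : CodingEpoch m F) (p : V) (B : ∀ i, Fin (m i) → V) : ∀ i, Fin (m i) → V :=
  fun i k => B i k + if z.ok i.castSucc then z.b i k • rlncSent z p B i.castSucc else 0

/-- Span of the packet, if any, that passes link `j`. -/
def arrived (z : CodingEpoch m F) (p : V) (B : ∀ i, Fin (m i) → V) (j : Fin (r + 1)) :
    Submodule F V :=
  if z.ok j then Submodule.span F {rlncSent z p B j} else ⊥

/-- Span of what the nodes behind link `j` hold, when `U` is what the destination knows. -/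
def behind (U : Submodule F V) (B : ∀ i, Fin (m i) → V) (j : Fin (r + 1)) : Submodule F V :=
  U ⊔ Submodule.span F {v | ∃ i k, j ≤ Fin.castSucc i ∧ v = B i k}

theorem le_behind (U : Submodule F V) (B : ∀ i, Fin (m i) → V) (j : Fin (r + 1)) :
    U ≤ behind U B j := le_sup_left

theorem mem_behind {U : Submodule F V} {B : ∀ i, Fin (m i) → V} {j : Fin (r + 1)} {i : Fin r}
    (h : j ≤ i.castSucc) (k : Fin (m i)) : B i k ∈ behind U B j :=
  Submodule.mem_sup_right (Submodule.subset_span ⟨i, k, h, rfl⟩)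

theorem behind_le {U X : Submodule F V} {B : ∀ i, Fin (m i) → V} {j : Fin (r + 1)} :
    behind U B j ≤ X ↔ U ≤ X ∧ ∀ i : Fin r, j ≤ i.castSucc → ∀ k, B i k ∈ X := by
  rw [behind, sup_le_iff, Submodule.span_le]
  refine and_congr_right fun _ => ⟨fun h i hi k => h ⟨i, k, hi, rfl⟩, ?_⟩
  rintro h _ ⟨i, k, hi, rfl⟩
  exact h i hi k

theorem behind_last (U : Submodule F V) (B : ∀ i, Fin (m i) → V) :
    behind U B (Fin.last r) = U :=
  le_antisymm (behind_le.2 ⟨le_rfl, fun i hi => absurd (Fin.castSucc_lt_last i) (not_lt.2 hi)⟩)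
    (le_behind _ _ _)

theorem behind_anti (U : Submodule F V) (B : ∀ i, Fin (m i) → V) {j k : Fin (r + 1)}
    (h : j ≤ k) : behind U B k ≤ behind U B j :=
  behind_le.2 ⟨le_behind _ _ _, fun _ hi l => mem_behind (h.trans hi) l⟩

theorem behind_castSucc (U : Submodule F V) (B : ∀ i, Fin (m i) → V) (i : Fin r) :
    behind U B i.castSucc = behind U B i.succ ⊔ Submodule.span F (Set.range (B i)) := by
  refine le_antisymm (behind_le.2 ⟨(le_behind _ _ _).trans le_sup_left, fun k hk l => ?_⟩)
    (sup_le (behind_anti U B Fin.castSucc_lt_succ.le) (Submodule.span_le.2 ?_))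
  · rcases hk.eq_or_lt with hk | hk
    · obtain rfl := Fin.castSucc_injective _ hk
      exact Submodule.mem_sup_right (Submodule.subset_span ⟨l, rfl⟩)
    · exact Submodule.mem_sup_left
        (mem_behind (Fin.succ_le_castSucc_iff.2 (Fin.castSucc_lt_castSucc_iff.1 hk)) l)
  · rintro _ ⟨l, rfl⟩
    exact mem_behind le_rfl l

theorem rlncSent_succ (z : CodingEpoch m F) (p : V) (B : ∀ i, Fin (m i) → V) (i : Fin r) :
    rlncSent z p B i.succ = ∑ k, z.a i k • B i k := rfl

theorem rlncSent_zero (z : CodingEpoch m F) (p : V) (B : ∀ i, Fin (m i) → V) :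
    rlncSent z p B 0 = p := rfl

theorem rlncSent_mem (z : CodingEpoch m F) (p : V) {B : ∀ i, Fin (m i) → V} {X : Submodule F V}
    {j k : Fin (r + 1)} (hjk : j < k) (h : ∀ i : Fin r, j ≤ i.castSucc → i.castSucc < k →
      ∀ l, B i l ∈ X) : rlncSent z p B k ∈ X := by
  induction k using Fin.cases with
  | zero => exact absurd hjk (Fin.not_lt_zero _)
  | succ i =>
    rw [rlncSent_succ]
    exact Submodule.sum_mem _ fun l _ => Submodule.smul_mem _ _
      (h i (Fin.le_castSucc_iff.2 hjk) Fin.castSucc_lt_succ l)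

theorem rlncSent_mem_behind (z : CodingEpoch m F) (p : V) (U : Submodule F V)
    (B : ∀ i, Fin (m i) → V) {j k : Fin (r + 1)} (hjk : j < k) :
    rlncSent z p B k ∈ behind U B j :=
  rlncSent_mem z p hjk fun _ hi _ l => mem_behind hi l

theorem arrived_le {z : CodingEpoch m F} {p : V} {B : ∀ i, Fin (m i) → V} {X : Submodule F V}
    {j : Fin (r + 1)} (h : z.ok j = true → rlncSent z p B j ∈ X) : arrived z p B j ≤ X := by
  unfold arrived
  split_ifs with hj
  · rw [Submodule.span_singleton_le_iff_mem]
    exact h hj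
  · exact bot_le

theorem rlncSent_mem_arrived {z : CodingEpoch m F} (p : V) (B : ∀ i, Fin (m i) → V)
    {j : Fin (r + 1)} (h : z.ok j = true) : rlncSent z p B j ∈ arrived z p B j := by
  rw [arrived, if_pos h]
  exact Submodule.mem_span_singleton_self _

variable (z : CodingEpoch m F) (p : V) (U : Submodule F V) (B : ∀ i, Fin (m i) → V)

/-- What the destination knows after the epoch. -/
def stepDest : Submodule F V := U ⊔ arrived z p B (Fin.last r)

theorem stepBuffers_mem_iff {X : Submodule F V} {i : Fin r} (h : arrived z p B i.castSucc ≤ X)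
    (k : Fin (m i)) : stepBuffers z p B i k ∈ X ↔ B i k ∈ X := by
  unfold stepBuffers
  refine Submodule.add_mem_iff_left _ ?_
  split_ifs with hi
  · exact Submodule.smul_mem _ _ (h (rlncSent_mem_arrived p B hi))
  · exact Submodule.zero_mem _

theorem behind_step_le (j : Fin (r + 1)) :
    behind (stepDest z p U B) (stepBuffers z p B) j ≤ behind U B j ⊔ arrived z p B j := by
  have harr : ∀ k, j ≤ k → arrived z p B k ≤ behind U B j ⊔ arrived z p B j := by
    intro k hk
    rcases hk.eq_or_lt with rfl | hk
    · exact le_sup_right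
    · exact arrived_le fun _ => Submodule.mem_sup_left (rlncSent_mem_behind z p U B hk)
  refine behind_le.2 ⟨sup_le ((le_behind U B j).trans le_sup_left) (harr _ (Fin.le_last j)),
    fun i hi k => ?_⟩
  rw [stepBuffers_mem_iff z p B (harr _ hi)]
  exact Submodule.mem_sup_left (mem_behind hi k)

/-- Nothing that was known behind link `j` is lost, except through the packet that enters there. -/
theorem behind_le_step (j : Fin (r + 1)) :
    behind U B j ≤ behind (stepDest z p U B) (stepBuffers z p B) j ⊔ arrived z p B j := by
  refine behind_le.2 ⟨le_trans le_sup_left ((le_behind _ _ _).trans le_sup_left), fun i => ?_⟩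
  induction i using WellFoundedLT.induction with
  | _ i ih =>
    intro hi k
    rw [← stepBuffers_mem_iff z p B ?_]
    · exact Submodule.mem_sup_left (mem_behind hi k)
    · rcases hi.eq_or_lt with rfl | hlt
      · exact le_sup_right
      · exact arrived_le fun _ => rlncSent_mem z p hlt fun l hl hl' =>
          ih l (Fin.castSucc_lt_castSucc_iff.1 hl') hl

theorem behind_succ_step_le (i : Fin r) :
    behind (stepDest z p U B) (stepBuffers z p B) i.succ ≤ behind U B i.castSucc :=
  (behind_step_le z p U B i.succ).trans (sup_le (behind_anti U B Fin.castSucc_lt_succ.le)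
    (arrived_le fun _ => rlncSent_mem_behind z p U B Fin.castSucc_lt_succ))

instance [FiniteDimensional F U] (j : Fin (r + 1)) : FiniteDimensional F (behind U B j) := by
  have : {v | ∃ i k, j ≤ Fin.castSucc i ∧ v = B i k}.Finite :=
    (Set.finite_range fun x : Σ i, Fin (m i) => B x.1 x.2).subset
      (by rintro _ ⟨i, k, _, rfl⟩; exact ⟨⟨i, k⟩, rfl⟩)
  have := FiniteDimensional.span_of_finite F this
  unfold behind
  infer_instance

instance (j : Fin (r + 1)) : FiniteDimensional F (arrived z p B j) := by
  by_cases h : z.ok j = true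
  · rw [arrived, if_pos h]
    infer_instance
  · rw [arrived, if_neg h]
    infer_instance

instance [FiniteDimensional F U] : FiniteDimensional F (stepDest z p U B) := by
  unfold stepDest
  infer_instance

theorem finrank_arrived_le (j : Fin (r + 1)) :
    Module.finrank F (arrived z p B j) ≤ (z.ok j).toNat := by
  by_cases h : z.ok j = true
  · rw [arrived, if_pos h, h]
    exact (finrank_span_le_card _).trans (by simp)
  · rw [arrived, if_neg h, finrank_bot]
    exact Nat.zero_le _

theorem finrank_sup_span_singleton_eq {V : Type*} [AddCommGroup V] [Module F V]
    (U : Submodule F V) [FiniteDimensional F U] {v : V}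
    (hv : v ∉ U) : Module.finrank F ↥(U ⊔ Submodule.span F {v}) = Module.finrank F U + 1 := by
  have h0 : v ≠ 0 := fun h => hv (h ▸ U.zero_mem)
  have h1 := Submodule.finrank_sup_add_finrank_inf_eq U (Submodule.span F {v})
  have h2 : U ⊓ Submodule.span F {v} = ⊥ :=
    disjoint_iff.1 ((Submodule.disjoint_span_singleton' h0).2 hv)
  rw [h2, finrank_bot, finrank_span_singleton h0] at h1
  omega

end CodingStep

/-! ### The dimension received is at most the flow -/

section UpperBound

variable {r : ℕ} {m : Fin r → ℕ} {F V : Type*} [Field F] [AddCommGroup V] [Module F V]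

/-- Span of the packets received by the destination in the epochs before `t`. -/
def dest (src : ℕ → V) (z : ℕ → CodingEpoch m F) : ℕ → Submodule F V
  | 0 => ⊥
  | t + 1 => stepDest (z t) (src t) (dest src z t) (rlncBuffers src z t)

instance (src : ℕ → V) (z : ℕ → CodingEpoch m F) (t : ℕ) :
    FiniteDimensional F (dest src z t) := by
  induction t with
  | zero => exact inferInstanceAs (FiniteDimensional F (⊥ : Submodule F V))
  | succ t ih => exact inferInstanceAs (FiniteDimensional F (stepDest _ _ _ _))

theorem rlncBuffers_succ (src : ℕ → V) (z : ℕ → CodingEpoch m F) (t : ℕ) :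
    rlncBuffers src z (t + 1) = stepBuffers (z t) (src t) (rlncBuffers src z t) := rfl

theorem innovative_eq_finrank_dest (src : ℕ → V) (z : ℕ → CodingEpoch m F) (L : ℕ) :
    innovative src z L = Module.finrank F (dest src z L) := by
  have h : Submodule.span F {p : V | ∃ l < L, (z l).ok (Fin.last r) = true ∧
      p = rlncSent (z l) (src l) (rlncBuffers src z l) (Fin.last r)} = dest src z L := by
    induction L with
    | zero => simp [dest]
    | succ L ih =>
      refine le_antisymm (Submodule.span_le.2 ?_) (sup_le ?_ (arrived_le fun h => ?_))
      · rintro _ ⟨l, hl, hok, rfl⟩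
        rcases Nat.lt_succ_iff_lt_or_eq.1 hl with hl | rfl
        · refine Submodule.mem_sup_left ?_
          rw [← ih]
          exact Submodule.subset_span ⟨l, hl, hok, rfl⟩
        · exact Submodule.mem_sup_right (rlncSent_mem_arrived _ _ hok)
      · rw [← ih]
        refine Submodule.span_mono ?_
        rintro _ ⟨l, hl, hok, rfl⟩
        exact ⟨l, by omega, hok, rfl⟩
      · exact Submodule.subset_span ⟨L, by omega, h, rfl⟩
  rw [innovative, h]

theorem innovative_le_flow (src : ℕ → V) (z : ℕ → CodingEpoch m F) (L : ℕ) :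
    innovative src z L ≤ flow m (fun l => (z l).ok) (Fin.last r) L := by
  have key : Module.finrank F (behind (dest src z L) (rlncBuffers src z L) (Fin.last r)) ≤
      flow m (fun l => (z l).ok) (Fin.last r) L := by
    refine flow_induction (x := fun l => (z l).ok) (B := fun j t k =>
      Module.finrank F (behind (dest src z t) (rlncBuffers src z t) j) ≤ k)
      (fun j => ?_) (fun j t k h => ?_) (fun i t k h => ?_) (fun i t k h => ?_) L (Fin.last r)
    · have : behind (dest src z 0) (rlncBuffers src z 0) j = ⊥ :=
        eq_bot_iff.2 (behind_le.2 ⟨le_rfl, fun i _ k => by simp [rlncBuffers]⟩)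
      simp [this]
    · refine (Submodule.finrank_mono (behind_step_le _ _ _ _ j)).trans ?_
      refine (Submodule.finrank_add_le_finrank_add_finrank _ _).trans ?_
      exact add_le_add h (finrank_arrived_le _ _ _ j)
    · exact (Submodule.finrank_mono (behind_succ_step_le _ _ _ _ i)).trans h
    · rw [behind_castSucc]
      have := FiniteDimensional.span_of_finite F
        (Set.finite_range (rlncBuffers src z (t + 1) i))
      refine (Submodule.finrank_add_le_finrank_add_finrank _ _).trans (add_le_add h ?_)
      exact (finrank_range_le_card (R := F) (rlncBuffers src z (t + 1) i)).trans (by simp)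
  rwa [behind_last, ← innovative_eq_finrank_dest] at key

end UpperBound

/-! ### The chain of relations among the buffers -/

section Relations

variable {r : ℕ} {m : Fin r → ℕ} {F V V' : Type*} [Field F] [AddCommGroup V] [Module F V]
  [AddCommGroup V'] [Module F V']

/-- Coefficient vectors of linear combinations of all packets that are stored in the relays. -/
abbrev Coeff (m : Fin r → ℕ) (F : Type*) : Type _ := (Σ i, Fin (m i)) → F

/-- The linear combination of the stored packets with given coefficients. -/
def comb (B : ∀ i, Fin (m i) → V) : Coeff m F →ₗ[F] V :=
  Fintype.linearCombination F fun x : Σ i, Fin (m i) => B x.1 x.2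

theorem comb_apply (B : ∀ i, Fin (m i) → V) (c : Coeff m F) :
    comb B c = ∑ x, c x • B x.1 x.2 := rfl

theorem comb_single (B : ∀ i, Fin (m i) → V) (i : Fin r) (k : Fin (m i)) :
    comb B (Pi.single ⟨i, k⟩ (1 : F)) = B i k := by
  classical
  simp [comb, Fintype.linearCombination_apply_single]

/-- The relations: combinations of the stored packets that the destination knows. -/
def known (U : Submodule F V) (B : ∀ i, Fin (m i) → V) : Submodule F (Coeff m F) :=
  U.comap (comb B)

theorem map_rlncSent (T : V →ₗ[F] V') (z : CodingEpoch m F) (p : V) (B : ∀ i, Fin (m i) → V)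
    (j : Fin (r + 1)) :
    rlncSent z (T p) (fun i k => T (B i k)) j = T (rlncSent z p B j) := by
  induction j using Fin.cases with
  | zero => rfl
  | succ i => simp [rlncSent_succ]

theorem map_stepBuffers (T : V →ₗ[F] V') (z : CodingEpoch m F) (p : V)
    (B : ∀ i, Fin (m i) → V) (i : Fin r) (k : Fin (m i)) :
    stepBuffers z (T p) (fun i k => T (B i k)) i k = T (stepBuffers z p B i k) := by
  unfold stepBuffers
  rw [map_rlncSent]
  split_ifs <;> simp

theorem map_comb (T : V →ₗ[F] V') (B : ∀ i, Fin (m i) → V) (c : Coeff m F) :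
    comb (fun i k => T (B i k)) c = T (comb B c) := by
  simp [comb_apply]

/-- The free buffers: the stored packets are the unit vectors, next to the source packet. -/
def freeBuffers (m : Fin r → ℕ) (F : Type*) [Field F] : ∀ i, Fin (m i) → Coeff m F × F :=
  fun i k => (Pi.single ⟨i, k⟩ 1, 0)

/-- The free source packet, independent of all stored packets. -/
def freePacket (m : Fin r → ℕ) (F : Type*) [Field F] : Coeff m F × F := (0, 1)

theorem comb_freeBuffers (c : Coeff m F) : comb (freeBuffers m F) c = (c, 0) := by
  classical
  have h : freeBuffers m F = fun i k => LinearMap.inl F (Coeff m F) F (Pi.single ⟨i, k⟩ 1) := rfl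
  rw [h, map_comb (LinearMap.inl F (Coeff m F) F) fun i k => (Pi.single ⟨i, k⟩ 1 : Coeff m F)]
  have h1 : comb (fun i k => (Pi.single ⟨i, k⟩ 1 : Coeff m F)) c = c := by
    rw [comb_apply]
    ext x
    simp [Finset.sum_apply, Pi.single_apply]
  rw [h1]
  rfl

/-- The relations after an epoch. They are determined by the relations before it, and computed in
the free buffers modulo these relations. -/
def nextKnown (K : Submodule F (Coeff m F)) (z : CodingEpoch m F) : Submodule F (Coeff m F) :=
  known (stepDest z (freePacket m F) (K.prod ⊥) (freeBuffers m F))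
    (stepBuffers z (freePacket m F) (freeBuffers m F))

open Classical in
/-- Whether the destination receives an innovative packet. -/
def innovation (K : Submodule F (Coeff m F)) (z : CodingEpoch m F) : ℕ :=
  if z.ok (Fin.last r) = true ∧
    rlncSent z (freePacket m F) (freeBuffers m F) (Fin.last r) ∉ K.prod ⊥ then 1 else 0

/-- The source packet is independent of everything that is stored or known. -/
def Fresh (U : Submodule F V) (B : ∀ i, Fin (m i) → V) (p : V) : Prop :=
  ∀ (c : Coeff m F) (t : F), comb B c + t • p ∈ U → t = 0

theorem fresh_free (K : Submodule F (Coeff m F)) :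
    Fresh (K.prod ⊥) (freeBuffers m F) (freePacket m F) := by
  intro c t h
  rw [comb_freeBuffers] at h
  simpa [freePacket] using h.2

theorem known_free (K : Submodule F (Coeff m F)) :
    known (K.prod ⊥) (freeBuffers m F) = K := by
  ext c
  simp [known, comb_freeBuffers]

/-- The specialization of the free packets to given ones. -/
def specialize (B : ∀ i, Fin (m i) → V) (p : V) : Coeff m F × F →ₗ[F] V :=
  (comb B).coprod (LinearMap.toSpanSingleton F V p)

theorem specialize_freeBuffers (B : ∀ i, Fin (m i) → V) (p : V) :
    (fun i k => specialize B p (freeBuffers m F i k)) = B := by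
  funext i k
  simp [specialize, freeBuffers, comb_single]

theorem specialize_freePacket (B : ∀ i, Fin (m i) → V) (p : V) :
    specialize B p (freePacket m F) = p := by
  simp [specialize, freePacket]

theorem comap_specialize {U : Submodule F V} {B : ∀ i, Fin (m i) → V} {p : V}
    (h : Fresh U B p) : U.comap (specialize B p) = (known U B).prod ⊥ := by
  ext ⟨c, t⟩
  simp only [Submodule.mem_comap, specialize, LinearMap.coprod_apply, Submodule.mem_prod,
    LinearMap.toSpanSingleton_apply, Submodule.mem_bot, known]
  constructor
  · intro h1
    have h2 := h c t h1
    subst h2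
    simpa using h1
  · rintro ⟨h1, rfl⟩
    simpa using h1

theorem comap_sup_span_singleton (T : V →ₗ[F] V') (U : Submodule F V') (y : V) :
    (U ⊔ Submodule.span F {T y}).comap T = U.comap T ⊔ Submodule.span F {y} := by
  refine le_antisymm (fun v hv => ?_) (sup_le (Submodule.comap_mono le_sup_left) ?_)
  · obtain ⟨u, hu, w, hw, huw⟩ := Submodule.mem_sup.1 (Submodule.mem_comap.1 hv)
    obtain ⟨a, rfl⟩ := Submodule.mem_span_singleton.1 hw
    have h1 : v = (v - a • y) + a • y := by abel
    rw [h1]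
    refine Submodule.add_mem_sup ?_ (Submodule.smul_mem _ _ (Submodule.mem_span_singleton_self y))
    rw [Submodule.mem_comap, map_sub, map_smul, ← huw, add_sub_cancel_right]
    exact hu
  · rw [Submodule.span_singleton_le_iff_mem]
    exact Submodule.mem_sup_right (Submodule.mem_span_singleton_self _)

variable {U : Submodule F V} {B : ∀ i, Fin (m i) → V} {p : V}

theorem rlncSent_specialize (B : ∀ i, Fin (m i) → V) (p : V) (z : CodingEpoch m F)
    (j : Fin (r + 1)) : rlncSent z p B j =
      specialize B p (rlncSent z (freePacket m F) (freeBuffers m F) j) := by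
  rw [← map_rlncSent, specialize_freeBuffers, specialize_freePacket]

theorem known_step (h : Fresh U B p) (z : CodingEpoch m F) :
    known (stepDest z p U B) (stepBuffers z p B) = nextKnown (known U B) z := by
  have h1 : stepBuffers z p B = fun i k => specialize (F := F) B p
      (stepBuffers z (freePacket m F) (freeBuffers m F) i k) := by
    funext i k
    rw [← map_stepBuffers, specialize_freeBuffers, specialize_freePacket]
  have h2 : (stepDest z p U B).comap (specialize B p) =
      stepDest z (freePacket m F) ((known U B).prod ⊥) (freeBuffers m F) := by
    unfold stepDest arrived
    split_ifs
    · rw [rlncSent_specialize, comap_sup_span_singleton, comap_specialize h]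
    · rw [sup_bot_eq, sup_bot_eq, comap_specialize h]
  ext c
  rw [nextKnown, known, known, ← h2, Submodule.mem_comap, Submodule.mem_comap,
    Submodule.mem_comap, ← map_comb, ← h1]

theorem finrank_stepDest [FiniteDimensional F U] (h : Fresh U B p) (z : CodingEpoch m F) :
    Module.finrank F (stepDest z p U B) = Module.finrank F U + innovation (known U B) z := by
  have h1 : rlncSent z (freePacket m F) (freeBuffers m F) (Fin.last r) ∈ (known U B).prod ⊥ ↔
      rlncSent z p B (Fin.last r) ∈ U := by
    rw [← comap_specialize h, Submodule.mem_comap, ← rlncSent_specialize]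
  rw [stepDest, arrived, innovation, h1]
  by_cases hok : z.ok (Fin.last r) = true
  · rw [if_pos hok]
    by_cases hU : rlncSent z p B (Fin.last r) ∈ U
    · rw [if_neg fun h => h.2 hU, sup_eq_left.2, add_zero]
      rwa [Submodule.span_singleton_le_iff_mem]
    · rw [if_pos ⟨hok, hU⟩, finrank_sup_span_singleton_eq U hU]
  · rw [if_neg hok, if_neg fun h => hok h.1, sup_bot_eq, add_zero]

/-- Before epoch `t` only combinations of the source packets of the epochs before `t` circulate. -/
theorem dest_and_rlncBuffers_le_span {src : ℕ → V} {z : ℕ → CodingEpoch m F} (t : ℕ) :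
    dest src z t ≤ Submodule.span F (src '' Set.Iio t) ∧
      ∀ i k, rlncBuffers src z t i k ∈ Submodule.span F (src '' Set.Iio t) := by
  induction t with
  | zero => exact ⟨bot_le, fun i k => Submodule.zero_mem _⟩
  | succ t ih =>
    have hmono : Submodule.span F (src '' Set.Iio t) ≤ Submodule.span F (src '' Set.Iio (t + 1)) :=
      Submodule.span_mono (Set.image_mono fun l hl => Nat.lt_succ_of_lt hl)
    have hB : ∀ i k, rlncBuffers src z t i k ∈ Submodule.span F (src '' Set.Iio (t + 1)) :=
      fun i k => hmono (ih.2 i k)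
    have hsent : ∀ j, rlncSent (z t) (src t) (rlncBuffers src z t) j ∈
        Submodule.span F (src '' Set.Iio (t + 1)) := by
      intro j
      induction j using Fin.cases with
      | zero => exact Submodule.subset_span ⟨t, Nat.lt_succ_self t, rfl⟩
      | succ i => exact rlncSent_mem _ _ (Fin.succ_pos i) fun i _ _ l => hB i l
    refine ⟨sup_le (ih.1.trans hmono) (arrived_le fun _ => hsent _), fun i k => ?_⟩
    rw [rlncBuffers_succ, stepBuffers_mem_iff _ _ _ (arrived_le fun _ => hsent _)]
    exact hB i k

theorem fresh_src {src : ℕ → V} (hsrc : LinearIndependent F src) (z : ℕ → CodingEpoch m F)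
    (t : ℕ) : Fresh (dest src z t) (rlncBuffers src z t) (src t) := by
  intro c a h
  by_contra ha
  obtain ⟨h1, h2⟩ := dest_and_rlncBuffers_le_span (src := src) (z := z) t
  have h3 : comb (rlncBuffers src z t) c ∈ Submodule.span F (src '' Set.Iio t) := by
    rw [comb_apply]
    exact Submodule.sum_mem _ fun x _ => Submodule.smul_mem _ _ (h2 _ _)
  have h4 := (Submodule.add_mem_iff_right _ h3).1 (h1 h)
  rw [Submodule.smul_mem_iff _ ha] at h4
  exact hsrc.notMem_span_image (s := Set.Iio t) (by simp) h4

theorem known_eq_trajectory {src : ℕ → V} (hsrc : LinearIndependent F src)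
    (z : ℕ → CodingEpoch m F) (t : ℕ) :
    known (dest src z t) (rlncBuffers src z t) = trajectory nextKnown ⊤ z t := by
  induction t with
  | zero =>
    refine eq_top_iff.2 fun c _ => ?_
    simp [known, dest, comb_apply, rlncBuffers]
  | succ t ih => exact (known_step (fresh_src hsrc z t) (z t)).trans (by rw [ih]; rfl)

/-- The number of innovative packets is the total reward of a chain that does not involve the
source packets. -/
theorem innovative_eq_sum {src : ℕ → V} (hsrc : LinearIndependent F src)
    (z : ℕ → CodingEpoch m F) (L : ℕ) :
    innovative src z L = ∑ l ∈ Finset.range L, innovation (trajectory nextKnown ⊤ z l) (z l) := by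
  rw [innovative_eq_finrank_dest]
  induction L with
  | zero => exact finrank_bot F V
  | succ L ih =>
    rw [Finset.sum_range_succ, ← ih, ← known_eq_trajectory hsrc]
    exact finrank_stepDest (fresh_src hsrc z L) (z L)

theorem nextKnown_mono {K K' : Submodule F (Coeff m F)} (h : K ≤ K') (z : CodingEpoch m F) :
    nextKnown K z ≤ nextKnown K' z :=
  Submodule.comap_mono (sup_le_sup_right (Submodule.prod_mono h le_rfl) _)

theorem innovation_anti {K K' : Submodule F (Coeff m F)} (h : K ≤ K') (z : CodingEpoch m F) :
    innovation K' z ≤ innovation K z := by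
  unfold innovation
  split_ifs with h1 h2
  · exact le_rfl
  · exact absurd ⟨h1.1, fun h3 => h1.2 (Submodule.prod_mono h le_rfl h3)⟩ h2
  · exact Nat.zero_le _
  · exact le_rfl

/-! ### Ranks modulo the relations -/

/-- The number of packets behind link `j` that are unknown to the destination, as a function of
the relations. -/
def rankBehind (K : Submodule F (Coeff m F)) (j : Fin (r + 1)) : ℕ :=
  Module.finrank F ((behind ⊥ (fun i k => (Pi.single ⟨i, k⟩ 1 : Coeff m F)) j).map K.mkQ)

theorem finrank_map_eq_of_ker_eq {E W W' : Type*} [AddCommGroup E] [Module F E] [AddCommGroup W]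
    [Module F W] [AddCommGroup W'] [Module F W'] [FiniteDimensional F E] (X : Submodule F E)
    {f : E →ₗ[F] W} {g : E →ₗ[F] W'} (h : LinearMap.ker f = LinearMap.ker g) :
    Module.finrank F (X.map f) = Module.finrank F (X.map g) := by
  have h1 := LinearMap.finrank_range_add_finrank_ker (f.domRestrict X)
  have h2 := LinearMap.finrank_range_add_finrank_ker (g.domRestrict X)
  rw [LinearMap.range_domRestrict, LinearMap.ker_domRestrict] at h1 h2
  rw [h] at h1
  omega

theorem finrank_sup_eq_add_map_mkQ [FiniteDimensional F V] (U X : Submodule F V) :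
    Module.finrank F ↥(U ⊔ X) = Module.finrank F U + Module.finrank F (X.map U.mkQ) := by
  have h1 := LinearMap.finrank_range_add_finrank_ker (U.mkQ.domRestrict (U ⊔ X))
  rw [LinearMap.range_domRestrict, LinearMap.ker_domRestrict, Submodule.ker_mkQ,
    Submodule.map_sup, Submodule.mkQ_map_self, bot_sup_eq] at h1
  have h2 : Module.finrank F (U.submoduleOf (U ⊔ X)) = Module.finrank F U :=
    (Submodule.submoduleOfEquivOfLe le_sup_left).finrank_eq
  have h3 : Submodule.comap (U ⊔ X).subtype U = U.submoduleOf (U ⊔ X) := rfl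
  rw [h3, h2] at h1
  omega

theorem finrank_behind [FiniteDimensional F V] (U : Submodule F V) (B : ∀ i, Fin (m i) → V)
    (j : Fin (r + 1)) :
    Module.finrank F (behind U B j) = Module.finrank F U + rankBehind (known U B) j := by
  classical
  have h1 : behind U B j =
      U ⊔ (behind ⊥ (fun i k => (Pi.single ⟨i, k⟩ 1 : Coeff m F)) j).map (comb B) := by
    rw [behind, behind, bot_sup_eq, Submodule.map_span]
    congr 2
    ext v
    constructor
    · rintro ⟨i, k, hi, rfl⟩
      exact ⟨_, ⟨i, k, hi, rfl⟩, comb_single B i k⟩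
    · rintro ⟨_, ⟨i, k, hi, rfl⟩, rfl⟩
      exact ⟨i, k, hi, comb_single B i k⟩
  rw [h1, finrank_sup_eq_add_map_mkQ, ← Submodule.map_comp, rankBehind]
  congr 1
  refine finrank_map_eq_of_ker_eq _ ?_
  rw [LinearMap.ker_comp, Submodule.ker_mkQ, Submodule.ker_mkQ]
  rfl

theorem rankBehind_last (K : Submodule F (Coeff m F)) : rankBehind K (Fin.last r) = 0 := by
  have h := finrank_behind (K.prod ⊥) (freeBuffers m F) (Fin.last r)
  rw [behind_last, known_free] at h
  omega

/-! ### The state in which everything is known can be reached -/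

/-- The epoch in which only link `i.succ` is not erased, relay `i` transmits its packet `k` and the
receiver adds it to all its slots. -/
def forwardEpoch (m : Fin r → ℕ) (F : Type*) [Field F] (i : Fin r) (k : Fin (m i)) :
    CodingEpoch m F where
  ok j := decide (j = i.succ)
  a := Function.update 0 i (Pi.single k 1)
  b := 1

theorem rlncSent_forwardEpoch (p : V) (B : ∀ i, Fin (m i) → V) (i : Fin r) (k : Fin (m i)) :
    rlncSent (forwardEpoch m F i k) p B i.succ = B i k := by
  simp [rlncSent_succ, forwardEpoch, Pi.single_apply]

/-- While the source is erased, the number of unknown stored packets cannot grow, and it drops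
whenever the destination receives an innovative packet. -/
theorem rankBehind_zero_nextKnown_le (K : Submodule F (Coeff m F)) {z : CodingEpoch m F}
    (hz : z.ok 0 = false) :
    rankBehind (nextKnown K z) 0 + innovation K z ≤ rankBehind K 0 := by
  have h1 := behind_step_le z (freePacket m F) (K.prod ⊥) (freeBuffers m F) 0
  have h2 : arrived z (freePacket m F) (freeBuffers m F) 0 = ⊥ := by simp [arrived, hz]
  rw [h2, sup_bot_eq] at h1
  have h3 := Submodule.finrank_mono h1
  rw [finrank_behind, finrank_behind, finrank_stepDest (fresh_free K), known_free] at h3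
  change _ + rankBehind (nextKnown K z) 0 ≤ _ at h3
  omega

/-- From relations with the least number of unknown packets, any packet that is passed on must
already be known. -/
theorem reachable_nextKnown (hm : ∀ i, 0 < m i) :
    Reachable (nextKnown (m := m) (F := F)) ⊤ := by
  intro K₀
  classical
  let step : Submodule F (Coeff m F) → Submodule F (Coeff m F) → Prop :=
    fun s t => ∃ z, nextKnown s z = t
  have hex : ∃ n K, Relation.ReflTransGen step K₀ K ∧ rankBehind K 0 = n := ⟨_, K₀, .refl, rfl⟩
  have hmin : ∀ K, Relation.ReflTransGen step K₀ K → Nat.find hex ≤ rankBehind K 0 :=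
    fun K hK => Nat.find_min' hex ⟨K, hK, rfl⟩
  have key : ∀ i : Fin r, ∀ K, Relation.ReflTransGen step K₀ K → rankBehind K 0 = Nat.find hex →
      ∀ k, Pi.single ⟨i, k⟩ 1 ∈ K := by
    intro i
    induction i using WellFoundedGT.induction with
    | _ i ih =>
      intro K hK hKmin k
      set z := forwardEpoch m F i k with hz
      have hz0 : z.ok 0 = false := decide_eq_false (Fin.succ_ne_zero i).symm
      have hK' : Relation.ReflTransGen step K₀ (nextKnown K z) := hK.tail ⟨z, rfl⟩
      have hle := rankBehind_zero_nextKnown_le K hz0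
      -- The number of unknown packets stays minimal, so the induction hypothesis applies after
      -- the epoch as well.
      have hK'min : rankBehind (nextKnown K z) 0 = Nat.find hex :=
        le_antisymm (by omega) (hmin _ hK')
      rcases Fin.eq_castSucc_or_eq_last i.succ with ⟨l, hl⟩ | hl
      · have hil : i < l := by
          have := congrArg Fin.val hl
          simp only [Fin.val_succ, Fin.val_castSucc] at this
          exact Fin.lt_def.2 (by omega)
        have h1 := ih l hil _ hK' hK'min ⟨0, hm l⟩
        have h2 := ih l hil _ hK hKmin ⟨0, hm l⟩
        have hlast : arrived z (freePacket m F) (freeBuffers m F) (Fin.last r) = ⊥ := by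
          have : Fin.last r ≠ i.succ := fun h => (Fin.castSucc_lt_last l).ne (hl ▸ h.symm)
          simp [arrived, hz, forwardEpoch, this]
        rw [nextKnown, known, Submodule.mem_comap, comb_single, stepDest, hlast, sup_bot_eq,
          stepBuffers, ← hl] at h1
        rw [hz, rlncSent_forwardEpoch] at h1
        simp only [forwardEpoch, decide_true, if_true, Pi.one_apply, one_smul] at h1
        have h3 : freeBuffers m F l ⟨0, hm l⟩ ∈ K.prod ⊥ := ⟨h2, rfl⟩
        exact ((Submodule.add_mem_iff_right _ h3).1 h1).1
      · by_contra hne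
        have h1 : innovation K z = 1 := by
          refine if_pos ⟨?_, fun h => hne ?_⟩
          · simp [hz, forwardEpoch, hl]
          · rw [← hl, hz, rlncSent_forwardEpoch] at h
            exact h.1
        omega
  obtain ⟨K, hK, hKmin⟩ := Nat.find_spec hex
  have htop : K = ⊤ := by
    refine eq_top_iff.2 fun c _ => ?_
    rw [← Finset.univ_sum_single c]
    refine Submodule.sum_mem _ fun x _ => ?_
    have h1 : Pi.single x (c x) = c x • (Pi.single ⟨x.1, x.2⟩ 1 : Coeff m F) := by
      rw [← Pi.single_smul, smul_eq_mul, mul_one]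
    rw [h1]
    exact Submodule.smul_mem _ _ (key x.1 K hK hKmin x.2)
  rw [← htop]
  exact hK

end Relations

/-! ### Good coefficients make the ranks follow the occupancy chain -/

section Good

variable {r : ℕ} {m : Fin r → ℕ} {F V : Type*} [Field F] [AddCommGroup V] [Module F V]

/-- The coefficients `a` of relay `i` are good: if the relay has something new for the nodes behind
its outgoing link, then what it transmits is new. -/
def GoodSent (z : CodingEpoch m F) (p : V) (U : Submodule F V) (B : ∀ i, Fin (m i) → V)
    (i : Fin r) : Prop :=
  Submodule.span F (Set.range (B i)) ≤ behind U B i.succ ∨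
    rlncSent z p B i.succ ∉ behind U B i.succ

/-- The coefficients `b` of relay `i` are good: the packet on its incoming link is retained, or the
buffer is full of packets that are new to the nodes behind the relay. -/
def GoodStored (z : CodingEpoch m F) (p : V) (U : Submodule F V) (B : ∀ i, Fin (m i) → V)
    (i : Fin r) : Prop :=
  rlncSent z p B i.castSucc ∈ behind (stepDest z p U B) (stepBuffers z p B) i.castSucc ∨
    Module.finrank F (behind (stepDest z p U B) (stepBuffers z p B) i.succ) + m i ≤
      Module.finrank F (behind (stepDest z p U B) (stepBuffers z p B) i.castSucc)

variable {z : CodingEpoch m F} {p : V} {U : Submodule F V} {B : ∀ i, Fin (m i) → V}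
  {n : Fin r → ℕ}

theorem finrank_behind_sup_arrived [FiniteDimensional F V] (hf : Fresh U B p)
    (hn : ∀ i : Fin r, Module.finrank F (behind U B i.castSucc) =
      n i + Module.finrank F (behind U B i.succ))
    (hg : ∀ i, GoodSent z p U B i) (j : Fin (r + 1)) :
    Module.finrank F ↥(behind U B j ⊔ arrived z p B j) =
      Module.finrank F (behind U B j) + (z.ok j && decide (HasPacket n j)).toNat := by
  cases hok : z.ok j
  · have harr : arrived z p B j = ⊥ := by simp [arrived, hok]
    rw [harr, sup_bot_eq]
    simp
  · have harr : arrived z p B j = Submodule.span F {rlncSent z p B j} := by simp [arrived, hok]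
    rw [harr]
    by_cases hp : HasPacket n j
    · rw [finrank_sup_span_singleton_eq]
      · simp [hp]
      · induction j using Fin.cases with
        | zero =>
          rw [rlncSent_zero]
          intro h
          -- A combination of stored packets and the source packet would be known.
          obtain ⟨u, hu, v, hv, huv⟩ := Submodule.mem_sup.1 h
          have h1 : v ∈ LinearMap.range (comb (F := F) B) := by
            refine Submodule.span_le.2 ?_ hv
            rintro _ ⟨i, k, _, rfl⟩
            exact ⟨Pi.single ⟨i, k⟩ 1, comb_single B i k⟩
          obtain ⟨c, rfl⟩ := h1
          have h2 := hf (-c) 1 (by rw [one_smul, map_neg, ← huv]; simpa using hu)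
          exact one_ne_zero h2
        | succ i =>
          refine (hg i).resolve_left fun h => ?_
          have h1 := hn i
          have h2 := hasPacket_succ.1 hp
          rw [behind_castSucc, sup_eq_left.2 h] at h1
          omega
    · have h1 : rlncSent z p B j ∈ behind U B j := by
        induction j using Fin.cases with
        | zero => exact absurd (hasPacket_zero n) hp
        | succ i =>
          have h1 := hn i
          rw [hasPacket_succ] at hp
          have h2 : behind U B i.succ = behind U B i.castSucc :=
            Submodule.eq_of_le_of_finrank_le (behind_anti U B Fin.castSucc_lt_succ.le) (by omega)
          rw [h2]
          exact rlncSent_mem_behind z p U B Fin.castSucc_lt_succ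
      rw [sup_eq_left.2 (by rwa [Submodule.span_singleton_le_iff_mem])]
      simp [hp]

/-- With good coefficients, the dimension behind every link grows exactly when a packet moves over
the link in the occupancy chain. -/
theorem finrank_behind_step [FiniteDimensional F V] (hf : Fresh U B p)
    (hn : ∀ i : Fin r, Module.finrank F (behind U B i.castSucc) =
      n i + Module.finrank F (behind U B i.succ))
    (hnm : ∀ i, n i ≤ m i) (hg : ∀ i, GoodSent z p U B i)
    (hg' : ∀ i, z.ok i.castSucc = true → GoodStored z p U B i) (j : Fin (r + 1)) :
    Module.finrank F (behind (stepDest z p U B) (stepBuffers z p B) j) =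
      Module.finrank F (behind U B j) + (moves m n z.ok j).toNat := by
  have key := finrank_behind_sup_arrived hf hn hg
  induction j using Fin.reverseInduction with
  | last =>
    have h := key (Fin.last r)
    rw [behind_last] at h
    rw [behind_last, behind_last, moves_last, ← h]
    rfl
  | cast i ih =>
    have hk := key i.castSucc
    have hle := Submodule.finrank_mono (behind_step_le z p U B i.castSucc)
    have hge := behind_le_step z p U B i.castSucc
    have hni := hn i
    have hmi := hnm i
    rw [moves_castSucc]
    cases hok : z.ok i.castSucc
    · have harr : arrived z p B i.castSucc = ⊥ := by simp [arrived, hok]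
      rw [harr, sup_bot_eq] at hle hge
      simpa using le_antisymm hle (Submodule.finrank_mono hge)
    · rw [hok, Bool.true_and] at hk
      rw [Bool.true_and]
      have h3 : Module.finrank F
          (behind (stepDest z p U B) (stepBuffers z p B) i.castSucc) ≤
          Module.finrank F (behind (stepDest z p U B) (stepBuffers z p B) i.succ) + m i := by
        rw [behind_castSucc]
        have := FiniteDimensional.span_of_finite F (Set.finite_range (stepBuffers z p B i))
        refine (Submodule.finrank_add_le_finrank_add_finrank _ _).trans
          (Nat.add_le_add_left ?_ _)
        exact (finrank_range_le_card (R := F) (stepBuffers z p B i)).trans (by simp)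
      rcases hg' i hok with h | h
      · -- The packet is retained: nothing is lost behind the link.
        have harr : arrived z p B i.castSucc ≤
            behind (stepDest z p U B) (stepBuffers z p B) i.castSucc := arrived_le fun _ => h
        rw [sup_eq_left.2 harr] at hge
        have h2 := Submodule.finrank_mono (sup_le hge harr)
        by_cases hp : HasPacket n i.castSucc
        · simp only [hp, decide_true, Bool.toNat_true] at hk
          simp only [hp, decide_true, Bool.true_and]
          rw [decide_eq_true (by omega), Bool.toNat_true]
          omega
        · simp only [hp, decide_false, Bool.toNat_false] at hk
          simp only [hp, decide_false, Bool.false_and, Bool.toNat_false]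
          omega
      · -- The buffer is full.
        by_cases hp : HasPacket n i.castSucc
        · simp only [hp, decide_true, Bool.toNat_true] at hk
          simp only [hp, decide_true, Bool.true_and]
          by_cases hlt : n i < m i + (moves m n z.ok i.succ).toNat
          · rw [decide_eq_true hlt, Bool.toNat_true]
            omega
          · rw [decide_eq_false hlt, Bool.toNat_false]
            omega
        · simp only [hp, decide_false, Bool.toNat_false] at hk
          simp only [hp, decide_false, Bool.false_and, Bool.toNat_false]
          omega

/-- The ranks of the buffers modulo the relations `K` are the occupancies `n`. -/
def Matches (K : Submodule F (Coeff m F)) (n : Fin r → ℕ) : Prop :=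
  ∀ i : Fin r, rankBehind K i.castSucc = n i + rankBehind K i.succ

/-- All coefficients of the epoch are good, for the relations `K`. -/
def GoodEpoch (K : Submodule F (Coeff m F)) (z : CodingEpoch m F) : Prop :=
  (∀ i, GoodSent z (freePacket m F) (K.prod ⊥) (freeBuffers m F) i) ∧
    ∀ i, z.ok i.castSucc = true → GoodStored z (freePacket m F) (K.prod ⊥) (freeBuffers m F) i

theorem Matches.step {K : Submodule F (Coeff m F)} (h : Matches K n) (hnm : ∀ i, n i ≤ m i)
    (hg : GoodEpoch K z) : Matches (nextKnown K z) (nextOccupancy m n z.ok) ∧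
      innovation K z = (moves m n z.ok (Fin.last r)).toNat := by
  have hn : ∀ i : Fin r, Module.finrank F (behind (K.prod ⊥) (freeBuffers m F) i.castSucc) =
      n i + Module.finrank F (behind (K.prod ⊥) (freeBuffers m F) i.succ) := by
    intro i
    rw [finrank_behind, finrank_behind, known_free, h i]
    omega
  have key := finrank_behind_step (fresh_free K) hn hnm hg.1 hg.2
  simp only [finrank_behind, known_free] at key
  change ∀ j, _ + rankBehind (nextKnown K z) j = _ at key
  refine ⟨fun i => ?_, ?_⟩
  · have h1 := key i.castSucc
    have h2 := key i.succ
    have h3 := nextOccupancy_add m n z.ok i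
    have h4 := h i
    omega
  · have h1 := key (Fin.last r)
    have h2 := finrank_stepDest (fresh_free K) z
    rw [known_free] at h2
    rw [rankBehind_last, rankBehind_last] at h1
    omega

theorem matches_top : Matches (⊤ : Submodule F (Coeff m F)) 0 := by
  have h : ∀ j : Fin (r + 1), rankBehind (⊤ : Submodule F (Coeff m F)) j = 0 := by
    intro j
    unfold rankBehind
    have : (behind ⊥ (fun i k => (Pi.single ⟨i, k⟩ 1 : Coeff m F)) j).map
        (⊤ : Submodule F (Coeff m F)).mkQ = ⊥ := by
      rw [eq_bot_iff, ← Submodule.mkQ_map_self (⊤ : Submodule F (Coeff m F))]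
      exact Submodule.map_mono le_top
    rw [this, finrank_bot]
  intro i
  simp [h]

/-! ### Most coefficients are good -/

/-- A random combination of vectors that are not all in `W` avoids `W`, except for at most one
value of a suitable coefficient. -/
theorem exists_line_sent {k : ℕ} (hk : 0 < k) (u : Fin k → V) (W : Submodule F V) :
    ∃ l : Fin k, ∀ (v : Fin k → F) (t t' : F),
      ¬ (Submodule.span F (Set.range u) ≤ W ∨ ∑ i, Function.update v l t i • u i ∉ W) →
      ¬ (Submodule.span F (Set.range u) ≤ W ∨ ∑ i, Function.update v l t' i • u i ∉ W) →
      t = t' := by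
  by_cases h : Submodule.span F (Set.range u) ≤ W
  · exact ⟨⟨0, hk⟩, fun _ _ _ h1 => absurd (Or.inl h) h1⟩
  · have h1 : ∃ l, u l ∉ W := by
      by_contra! h1
      exact h (Submodule.span_le.2 (by rintro _ ⟨l, rfl⟩; exact h1 l))
    obtain ⟨l, hl⟩ := h1
    refine ⟨l, fun v t t' ht ht' => ?_⟩
    have ht := not_not.1 (not_or.1 ht).2
    have ht' := not_not.1 (not_or.1 ht').2
    have h2 : ∑ i, Function.update v l t i • u i - ∑ i, Function.update v l t' i • u i =
        (t - t') • u l := by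
      rw [← Finset.sum_sub_distrib, Finset.sum_eq_single l]
      · simp [sub_smul]
      · intro i _ hi
        simp [hi]
      · simp
    have h3 := W.sub_mem ht ht'
    rw [h2] at h3
    by_contra hne
    exact hl ((Submodule.smul_mem_iff W (sub_ne_zero.2 hne)).1 h3)

/-- Adding random multiples of `p` to the vectors `u` keeps `p` modulo `W` or leaves the vectors
independent modulo `W`, except for at most one value of a suitable coefficient: a relation
`∑ c_i u_i = κ p` modulo `W` puts `(κ + ∑ c_i b_i) p` into the new span. -/
theorem exists_line_stored [FiniteDimensional F V] {k : ℕ} (hk : 0 < k) (u : Fin k → V) (p : V)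
    (W : Submodule F V) : ∃ l : Fin k, ∀ (v : Fin k → F) (t t' : F),
      ¬ (p ∈ W ⊔ Submodule.span F (Set.range fun i => u i + Function.update v l t i • p) ∨
        Module.finrank F W + k ≤ Module.finrank F
          ↥(W ⊔ Submodule.span F (Set.range fun i => u i + Function.update v l t i • p))) →
      ¬ (p ∈ W ⊔ Submodule.span F (Set.range fun i => u i + Function.update v l t' i • p) ∨
        Module.finrank F W + k ≤ Module.finrank F
          ↥(W ⊔ Submodule.span F (Set.range fun i => u i + Function.update v l t' i • p))) →
      t = t' := by
  by_cases h : ∃ c : Fin k → F, c ≠ 0 ∧ ∃ κ : F, ∑ i, c i • u i - κ • p ∈ W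
  · obtain ⟨c, hc, κ, hκ⟩ := h
    obtain ⟨l, hl⟩ := Function.ne_iff.1 hc
    have key : ∀ b : Fin k → F,
        p ∉ W ⊔ Submodule.span F (Set.range fun i => u i + b i • p) →
        κ + ∑ i, c i * b i = 0 := by
      intro b hb
      by_contra hne
      refine hb ((Submodule.smul_mem_iff _ hne).1 ?_)
      have h1 : (κ + ∑ i, c i * b i) • p =
          -(∑ i, c i • u i - κ • p) + ∑ i, c i • (u i + b i • p) := by
        simp only [smul_add, Finset.sum_add_distrib, add_smul, Finset.sum_smul, smul_smul]
        abel
      rw [h1]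
      exact Submodule.add_mem_sup (W.neg_mem hκ) (Submodule.sum_mem _ fun i _ =>
        Submodule.smul_mem _ _ (Submodule.subset_span ⟨i, rfl⟩))
    refine ⟨l, fun v t t' ht ht' => ?_⟩
    have h1 := key _ (not_or.1 ht).1
    have h2 := key _ (not_or.1 ht').1
    have h3 : ∑ i, c i * Function.update v l t i - ∑ i, c i * Function.update v l t' i =
        c l * (t - t') := by
      rw [← Finset.sum_sub_distrib, Finset.sum_eq_single l]
      · simp [mul_sub]
      · intro i _ hi
        simp [hi]
      · simp
    have h4 : c l * (t - t') = 0 := by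
      rw [← h3]
      linear_combination h1 - h2
    exact sub_eq_zero.1 ((mul_eq_zero.1 h4).resolve_left hl)
  · refine ⟨⟨0, hk⟩, fun v t _ ht => absurd (Or.inr ?_) ht⟩
    set b := Function.update v ⟨0, hk⟩ t
    rw [finrank_sup_eq_add_map_mkQ, Submodule.map_span, ← Set.range_comp]
    have hli : LinearIndependent F (W.mkQ ∘ fun i => u i + b i • p) := by
      rw [Fintype.linearIndependent_iff]
      intro c hc
      by_contra! hne
      refine h ⟨c, fun h0 => ?_, -∑ i, c i * b i, ?_⟩
      · obtain ⟨i, hi⟩ := hne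
        exact hi (congrFun h0 i)
      · have h1 : ∑ i, c i • (W.mkQ ∘ fun i => u i + b i • p) i =
            W.mkQ (∑ i, c i • u i - (-∑ i, c i * b i) • p) := by
          simp only [Function.comp_apply, ← map_smul, ← map_sum]
          congr 1
          simp only [smul_add, Finset.sum_add_distrib, neg_smul, sub_neg_eq_add, Finset.sum_smul,
            smul_smul]
        rw [h1] at hc
        rwa [Submodule.mkQ_apply, Submodule.Quotient.mk_eq_zero] at hc
    rw [finrank_span_eq_card hli, Fintype.card_fin]

theorem sum_sum_update {ι : Type*} [Fintype ι] [DecidableEq ι] {β : ι → Type*}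
    [∀ i, Fintype (β i)] (i : ι) (φ : (∀ i, β i) → ℕ) :
    ∑ f, ∑ v, φ (Function.update f i v) = Fintype.card (β i) * ∑ f, φ f := by
  have h : ∀ (v : β i), ∑ f, φ (Function.update f i v) =
      ∑ w : β i, ∑ g : ∀ j : {j // j ≠ i}, β j, φ ((Equiv.piSplitAt i β).symm (v, g)) := by
    intro v
    rw [← (Equiv.piSplitAt i β).symm.sum_comp, Fintype.sum_prod_type]
    refine Finset.sum_congr rfl fun w _ => Finset.sum_congr rfl fun g _ => ?_
    congr 1
    funext j
    by_cases hj : j = i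
    · subst hj
      simp [Equiv.piSplitAt]
    · simp [Equiv.piSplitAt, hj]
  rw [Finset.sum_comm]
  simp only [h, Finset.sum_const, Finset.card_univ, smul_eq_mul, ← Finset.mul_sum]
  rw [← (Equiv.piSplitAt i β).symm.sum_comp, Fintype.sum_prod_type]

/-- A set of coefficient arrays has density at most `1 / q` if, given all coefficients but those
of relay `i`, it contains at most one point of every line in some coordinate direction. -/
theorem card_mul_le_of_lines [Fintype F] [DecidableEq F] (S : (∀ i, Fin (m i) → F) → Prop)
    [DecidablePred S] (i : Fin r)
    (h : ∀ f, ∃ l : Fin (m i), ∀ (v : Fin (m i) → F) (t t' : F),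
      S (Function.update f i (Function.update v l t)) →
      S (Function.update f i (Function.update v l t')) → t = t') :
    (∑ f, if S f then 1 else 0) * Fintype.card F ≤ Fintype.card (∀ i, Fin (m i) → F) := by
  have h1 : ∀ f, (∑ v, if S (Function.update f i v) then 1 else 0) * Fintype.card F ≤
      Fintype.card (Fin (m i) → F) := by
    intro f
    obtain ⟨l, hl⟩ := h f
    have h2 := sum_sum_update l fun v : Fin (m i) → F =>
      if S (Function.update f i v) then 1 else 0
    rw [mul_comm, ← h2]
    refine (Finset.sum_le_card_nsmul _ _ 1 fun v _ => ?_).trans (by simp)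
    rw [Finset.sum_boole, Nat.cast_id, Finset.card_le_one]
    intro t ht t' ht'
    simp only [Finset.mem_filter, Finset.mem_univ, true_and] at ht ht'
    exact hl v t t' ht ht'
  have h3 := sum_sum_update i fun f : (∀ i, Fin (m i) → F) => if S f then 1 else 0
  have h4 : 0 < Fintype.card (Fin (m i) → F) := Fintype.card_pos
  refine Nat.le_of_mul_le_mul_left ?_ h4
  rw [← mul_assoc, ← h3, Finset.sum_mul]
  refine (Finset.sum_le_card_nsmul _ _ _ fun f _ => h1 f).trans ?_
  rw [Finset.card_univ, smul_eq_mul, mul_comm]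

open Classical in
theorem card_not_goodSent_mul_le [Fintype F] (hm : ∀ i, 0 < m i) (x : Fin (r + 1) → Bool)
    (b : ∀ i, Fin (m i) → F) (p : V) (U : Submodule F V) (B : ∀ i, Fin (m i) → V) (i : Fin r) :
    (∑ a, if ¬ GoodSent ⟨x, a, b⟩ p U B i then 1 else 0) * Fintype.card F ≤
      Fintype.card (∀ i, Fin (m i) → F) := by
  refine card_mul_le_of_lines _ i fun f => ?_
  obtain ⟨l, hl⟩ := exists_line_sent (hm i) (B i) (behind U B i.succ)
  refine ⟨l, fun v t t' h h' => hl v t t' ?_ ?_⟩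
  · simpa only [GoodSent, rlncSent_succ, Function.update_self] using h
  · simpa only [GoodSent, rlncSent_succ, Function.update_self] using h'

/-- What is stored behind a relay does not depend on the coefficients with which it stores. -/
theorem behind_step_update (x : Fin (r + 1) → Bool) (a b : ∀ i, Fin (m i) → F) (p : V)
    (U : Submodule F V) (B : ∀ i, Fin (m i) → V) (i : Fin r) (v : Fin (m i) → F) :
    behind (stepDest ⟨x, a, Function.update b i v⟩ p U B)
      (stepBuffers ⟨x, a, Function.update b i v⟩ p B) i.succ =
    behind (stepDest ⟨x, a, b⟩ p U B) (stepBuffers ⟨x, a, b⟩ p B) i.succ := by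
  have h1 : ∀ k : Fin r, i.succ ≤ k.castSucc →
      stepBuffers ⟨x, a, Function.update b i v⟩ p B k = stepBuffers ⟨x, a, b⟩ p B k := by
    intro k hk
    have hne : k ≠ i := by
      rintro rfl
      exact absurd Fin.castSucc_lt_succ (not_lt.2 hk)
    funext l
    simp only [stepBuffers, Function.update_of_ne hne]
    rfl
  refine le_antisymm ?_ ?_ <;>
    refine behind_le.2 ⟨le_behind _ _ _, fun k hk l => ?_⟩
  · rw [h1 k hk]
    exact mem_behind hk l
  · rw [← h1 k hk]
    exact mem_behind hk l

open Classical in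
theorem card_not_goodStored_mul_le [Fintype F] [FiniteDimensional F V] (hm : ∀ i, 0 < m i)
    (x : Fin (r + 1) → Bool) (a : ∀ i, Fin (m i) → F) (p : V) (U : Submodule F V)
    (B : ∀ i, Fin (m i) → V) (i : Fin r) :
    (∑ b, if ¬ (x i.castSucc = true → GoodStored ⟨x, a, b⟩ p U B i) then 1 else 0) *
      Fintype.card F ≤ Fintype.card (∀ i, Fin (m i) → F) := by
  refine card_mul_le_of_lines _ i fun f => ?_
  obtain ⟨l, hl⟩ := exists_line_stored (hm i) (B i)
    (rlncSent (⟨x, a, f⟩ : CodingEpoch m F) p B i.castSucc)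
    (behind (stepDest ⟨x, a, f⟩ p U B) (stepBuffers ⟨x, a, f⟩ p B) i.succ)
  have key : ∀ v : Fin (m i) → F, x i.castSucc = true →
      stepBuffers ⟨x, a, Function.update f i v⟩ p B i =
        fun k => B i k + v k • rlncSent (⟨x, a, f⟩ : CodingEpoch m F) p B i.castSucc := by
    intro v hx
    funext k
    simp only [stepBuffers, hx, if_true, Function.update_self]
    rfl
  refine ⟨l, fun v t t' h h' => ?_⟩
  rw [Classical.not_imp] at h h'
  refine hl v t t' ?_ ?_
  · have h2 := h.2
    rw [GoodStored, behind_castSucc, behind_step_update, key _ h.1] at h2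
    exact h2
  · have h2 := h'.2
    rw [GoodStored, behind_castSucc, behind_step_update, key _ h.1] at h2
    exact h2

end Good

/-! ### The innovation rate and its limit for large fields -/

section Rate

variable {r : ℕ} (ε : Fin (r + 1) → Set.Ioo (0 : ℝ) 1) (m : Fin r → ℕ) (F : Type*) [Field F]
  [Fintype F]

/-- The components of the randomness of an epoch. -/
def codingEpochEquiv {r : ℕ} (m : Fin r → ℕ) (F : Type*) : CodingEpoch m F ≃
    (Fin (r + 1) → Bool) × (∀ i, Fin (m i) → F) × (∀ i, Fin (m i) → F) where
  toFun z := (z.ok, z.a, z.b)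
  invFun y := ⟨y.1, y.2.1, y.2.2⟩
  left_inv _ := rfl
  right_inv _ := rfl

instance {r : ℕ} (m : Fin r → ℕ) (F : Type*) [Fintype F] : Fintype (CodingEpoch m F) := by
  classical
  exact Fintype.ofEquiv _ (codingEpochEquiv m F).symm

instance {r : ℕ} (m : Fin r → ℕ) (F : Type*) : MeasurableSingletonClass (CodingEpoch m F) :=
  ⟨fun _ => trivial⟩

/-- Law of the randomness of one epoch. -/
def epochLaw : Measure (CodingEpoch m F) := (codingEpochPMF ε m F).toMeasure

instance : IsProbabilityMeasure (epochLaw ε m F) :=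
  inferInstanceAs (IsProbabilityMeasure (codingEpochPMF ε m F).toMeasure)

instance : IsProbabilityMeasure (codingLaw ε m F) :=
  inferInstanceAs (IsProbabilityMeasure (Measure.infinitePi fun _ => epochLaw ε m F))

theorem real_epochLaw_singleton (z : CodingEpoch m F) : (epochLaw ε m F).real {z} =
    patternProb ε z.ok * ((Fintype.card (∀ i, Fin (m i) → F) : ℝ)⁻¹ *
      (Fintype.card (∀ i, Fin (m i) → F) : ℝ)⁻¹) := by
  classical
  obtain ⟨x, a, b⟩ := z
  rw [measureReal_def, epochLaw, PMF.toMeasure_apply_singleton _ _ (measurableSet_singleton _)]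
  simp only [codingEpochPMF, PMF.bind_apply, PMF.map_apply, PMF.uniformOfFintype_apply,
    tsum_fintype, CodingEpoch.mk.injEq]
  rw [Finset.sum_eq_single x, Finset.sum_eq_single a, Finset.sum_eq_single b]
  · simp [patternPMF, ENNReal.toReal_mul, ENNReal.toReal_ofReal (patternProb_nonneg ε x)]
  · intro b' _ hb
    simp [Ne.symm hb]
  · simp
  · intro a' _ ha
    simp [Ne.symm ha]
  · simp
  · intro x' _ hx
    simp [Ne.symm hx]
  · simp

theorem real_epochLaw_pos (z : CodingEpoch m F) : 0 < (epochLaw ε m F).real {z} := by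
  rw [real_epochLaw_singleton]
  have : 0 < Fintype.card (∀ i, Fin (m i) → F) := Fintype.card_pos
  have := patternProb_pos ε z.ok
  positivity

theorem sum_real_epochLaw : ∑ z, (epochLaw ε m F).real {z} = 1 := by
  rw [sum_measureReal_singleton, Finset.coe_univ, probReal_univ]

theorem sum_epochLaw_mul (φ : CodingEpoch m F → ℝ) :
    ∑ z, (epochLaw ε m F).real {z} * φ z = ∑ x, patternProb ε x *
      ((Fintype.card (∀ i, Fin (m i) → F) : ℝ)⁻¹ * ((Fintype.card (∀ i, Fin (m i) → F) : ℝ)⁻¹ *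
        ∑ a, ∑ b, φ ⟨x, a, b⟩)) := by
  classical
  rw [← (codingEpochEquiv m F).symm.sum_comp, Fintype.sum_prod_type]
  refine Finset.sum_congr rfl fun x _ => ?_
  rw [Fintype.sum_prod_type, Finset.mul_sum, Finset.mul_sum, Finset.mul_sum]
  refine Finset.sum_congr rfl fun a _ => ?_
  rw [Finset.mul_sum, Finset.mul_sum, Finset.mul_sum]
  refine Finset.sum_congr rfl fun b _ => ?_
  rw [real_epochLaw_singleton]
  simp only [codingEpochEquiv, Equiv.coe_fn_symm_mk]
  ring

theorem sum_epochLaw_mul_ok (ψ : (Fin (r + 1) → Bool) → ℝ) :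
    ∑ z, (epochLaw ε m F).real {z} * ψ z.ok = ∑ x, patternProb ε x * ψ x := by
  classical
  rw [sum_epochLaw_mul]
  refine Finset.sum_congr rfl fun x _ => ?_
  have h : (0 : ℝ) < Fintype.card (∀ i, Fin (m i) → F) := by
    exact_mod_cast Fintype.card_pos
  simp only [Finset.sum_const, Finset.card_univ, nsmul_eq_mul]
  field_simp

variable {m F}

open Classical in
/-- By the union bound over the relays, all coefficients are good but for a probability of order
`1 / q`. -/
theorem sum_not_goodEpoch_le (hm : ∀ i, 0 < m i) (K : Submodule F (Coeff m F)) :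
    ∑ z, (epochLaw ε m F).real {z} * (if GoodEpoch K z then 0 else 1) ≤
      2 * r / Fintype.card F := by
  set N := Fintype.card (∀ i, Fin (m i) → F)
  have hN : (0 : ℝ) < N := by exact_mod_cast (Fintype.card_pos : 0 < N)
  have hq : (0 : ℝ) < Fintype.card F := by exact_mod_cast Fintype.card_pos
  rw [sum_epochLaw_mul]
  refine sum_weight_mul_le (patternProb_pos ε) (sum_patternProb ε) fun x => ?_
  set p₀ := freePacket m F
  set B₀ := freeBuffers m F
  have hunion : ∀ a b, (if GoodEpoch K ⟨x, a, b⟩ then (0 : ℝ) else 1) ≤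
      (∑ i, if ¬ GoodSent ⟨x, a, b⟩ p₀ (K.prod ⊥) B₀ i then (1 : ℝ) else 0) +
      ∑ i : Fin r, if ¬ (x i.castSucc = true → GoodStored ⟨x, a, b⟩ p₀ (K.prod ⊥) B₀ i)
        then (1 : ℝ) else 0 := by
    intro a b
    have h1 : (0 : ℝ) ≤
        ∑ i, if ¬ GoodSent ⟨x, a, b⟩ p₀ (K.prod ⊥) B₀ i then (1 : ℝ) else 0 :=
      Finset.sum_nonneg fun i _ => by split_ifs <;> norm_num
    have h2 : (0 : ℝ) ≤
        ∑ i : Fin r, if ¬ (x i.castSucc = true → GoodStored ⟨x, a, b⟩ p₀ (K.prod ⊥) B₀ i)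
          then (1 : ℝ) else 0 :=
      Finset.sum_nonneg fun i _ => by split_ifs <;> norm_num
    split_ifs with hg
    · positivity
    · rw [GoodEpoch, not_and_or, not_forall, not_forall] at hg
      rcases hg with ⟨i, hi⟩ | ⟨i, hi⟩
      · have h3 := Finset.single_le_sum (f := fun i =>
          if ¬ GoodSent ⟨x, a, b⟩ p₀ (K.prod ⊥) B₀ i then (1 : ℝ) else 0)
          (fun i _ => by split_ifs <;> norm_num) (Finset.mem_univ i)
        rw [if_pos hi] at h3
        linarith
      · have h3 := Finset.single_le_sum (f := fun i : Fin r =>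
          if ¬ (x i.castSucc = true → GoodStored ⟨x, a, b⟩ p₀ (K.prod ⊥) B₀ i)
            then (1 : ℝ) else 0)
          (fun i _ => by split_ifs <;> norm_num) (Finset.mem_univ i)
        rw [if_pos hi] at h3
        linarith
  have hsent : ∀ b i, ∑ a, (if ¬ GoodSent ⟨x, a, b⟩ p₀ (K.prod ⊥) B₀ i then (1 : ℝ) else 0) ≤
      N / Fintype.card F := by
    intro b i
    rw [le_div_iff₀ hq]
    exact_mod_cast card_not_goodSent_mul_le hm x b p₀ (K.prod ⊥) B₀ i
  have hstored : ∀ a (i : Fin r), ∑ b, (if ¬ (x i.castSucc = true →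
      GoodStored ⟨x, a, b⟩ p₀ (K.prod ⊥) B₀ i) then (1 : ℝ) else 0) ≤ N / Fintype.card F := by
    intro a i
    rw [le_div_iff₀ hq]
    exact_mod_cast card_not_goodStored_mul_le hm x a p₀ (K.prod ⊥) B₀ i
  have htotal : ∑ a, ∑ b, (if GoodEpoch K ⟨x, a, b⟩ then (0 : ℝ) else 1) ≤
      N * (r * (N / Fintype.card F)) + N * (r * (N / Fintype.card F)) := by
    refine (Finset.sum_le_sum fun a _ => Finset.sum_le_sum fun b _ => hunion a b).trans ?_
    simp only [Finset.sum_add_distrib]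
    refine add_le_add ?_ ?_
    · rw [Finset.sum_comm]
      refine (Finset.sum_le_card_nsmul _ _ (r * ((N : ℝ) / Fintype.card F)) fun b _ => ?_).trans ?_
      · rw [Finset.sum_comm]
        refine (Finset.sum_le_card_nsmul _ _ _ fun i _ => hsent b i).trans ?_
        simp
      · rw [nsmul_eq_mul, Finset.card_univ]
    · refine (Finset.sum_le_card_nsmul _ _ (r * ((N : ℝ) / Fintype.card F)) fun a _ => ?_).trans ?_
      · rw [Finset.sum_comm]
        refine (Finset.sum_le_card_nsmul _ _ _ fun i _ => hstored a i).trans ?_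
        simp
      · rw [nsmul_eq_mul, Finset.card_univ]
  calc _ ≤ (N : ℝ)⁻¹ * ((N : ℝ)⁻¹ *
        (N * (r * (N / Fintype.card F)) + N * (r * (N / Fintype.card F)))) := by gcongr
    _ = _ := by
        field_simp
        ring

theorem totalReward_delivery_le (T : ℕ) (n : ∀ i, Fin (m i + 1)) :
    totalReward (patternProb ε) (occStep m) (delivery m) T n ≤ T := by
  induction T generalizing n with
  | zero => simp [totalReward]
  | succ T ih =>
    refine sum_weight_mul_le (patternProb_pos ε) (sum_patternProb ε) fun x => ?_
    have h1 : delivery m n x ≤ 1 := by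
      unfold delivery
      exact_mod_cast Bool.toNat_le _
    push_cast
    linarith [ih (occStep m n x)]

theorem totalReward_innovation_nonneg (T : ℕ) (K : Submodule F (Coeff m F)) :
    0 ≤ totalReward (fun z => (epochLaw ε m F).real {z}) nextKnown
      (fun K z => (innovation K z : ℝ)) T K := by
  induction T generalizing K with
  | zero => exact le_rfl
  | succ T ih =>
    exact Finset.sum_nonneg fun z _ => mul_nonneg (real_epochLaw_pos ε m F z).le
      (add_nonneg (Nat.cast_nonneg _) (ih _))

/-- The fewer relations, the more innovative packets. -/
theorem totalReward_innovation_anti (T : ℕ) {K K' : Submodule F (Coeff m F)} (h : K ≤ K') :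
    totalReward (fun z => (epochLaw ε m F).real {z}) nextKnown
      (fun K z => (innovation K z : ℝ)) T K' ≤
    totalReward (fun z => (epochLaw ε m F).real {z}) nextKnown
      (fun K z => (innovation K z : ℝ)) T K := by
  induction T generalizing K K' with
  | zero => exact le_rfl
  | succ T ih =>
    exact Finset.sum_le_sum fun z _ => mul_le_mul_of_nonneg_left
      (add_le_add (Nat.cast_le.2 (innovation_anti h z)) (ih (nextKnown_mono h z)))
      (real_epochLaw_pos ε m F z).le

/-- As long as all coefficients are good, network coding delivers as much as the occupancy chain; so
over `T` epochs it loses at most `T` packets with a probability of at most `T` times that of a bad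
epoch. -/
theorem totalReward_delivery_sub_le (hm : ∀ i, 0 < m i) (T : ℕ) {K : Submodule F (Coeff m F)}
    {n : ∀ i, Fin (m i + 1)} (h : Matches K fun i => n i) :
    totalReward (patternProb ε) (occStep m) (delivery m) T n -
      T ^ 2 * (2 * r / Fintype.card F) ≤
    totalReward (fun z => (epochLaw ε m F).real {z}) nextKnown
      (fun K z => (innovation K z : ℝ)) T K := by
  classical
  set κ : ℝ := 2 * r / Fintype.card F with hκ
  have hκ0 : 0 ≤ κ := by positivity
  induction T generalizing K n with
  | zero => simp [totalReward]
  | succ T ih =>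
    set ρ := totalReward (patternProb ε) (occStep m) (delivery m) T with hρ
    have h1 : ∀ z : CodingEpoch m F, delivery m n z.ok + ρ (occStep m n z.ok) - T ^ 2 * κ -
        (T + 1) * (if GoodEpoch K z then 0 else 1) ≤
        innovation K z + totalReward (fun z => (epochLaw ε m F).real {z}) nextKnown
          (fun K z => (innovation K z : ℝ)) T (nextKnown K z) := by
      intro z
      split_ifs with hg
      · obtain ⟨h2, h3⟩ := h.step (fun i => Nat.le_of_lt_succ (n i).2) hg
        have h4 := ih (n := occStep m n z.ok) h2
        rw [h3]
        unfold delivery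
        linarith
      · have h2 : delivery m n z.ok ≤ 1 := by
          unfold delivery
          exact_mod_cast Bool.toNat_le _
        have h3 := totalReward_delivery_le ε T (occStep m n z.ok)
        have h4 := totalReward_innovation_nonneg ε T (nextKnown K z)
        have h5 : (0 : ℝ) ≤ innovation K z := Nat.cast_nonneg _
        have h6 : 0 ≤ T ^ 2 * κ := by positivity
        linarith
    have h2 := Finset.sum_le_sum fun z (_ : z ∈ Finset.univ) =>
      mul_le_mul_of_nonneg_left (h1 z) (real_epochLaw_pos ε m F z).le
    have h3 := sum_epochLaw_mul_ok ε m F fun x => delivery m n x + ρ (occStep m n x)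
    have h4 := sum_not_goodEpoch_le ε hm K
    simp only [mul_sub, Finset.sum_sub_distrib, mul_left_comm _ ((T : ℝ) + 1), ← Finset.mul_sum,
      ← Finset.sum_mul, sum_real_epochLaw, h3, one_mul] at h2
    have h5 := mul_le_mul_of_nonneg_left h4 (by positivity : (0 : ℝ) ≤ T + 1)
    rw [← hκ] at h5
    have h6 : 0 ≤ T * κ := by positivity
    change (∑ x, patternProb ε x * (delivery m n x + ρ (occStep m n x))) - _ ≤ _
    refine le_trans ?_ h2
    push_cast
    nlinarith

theorem trajectory_comp_ok (s₀ : ∀ i, Fin (m i + 1)) {G : Type*}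
    (z : ℕ → CodingEpoch m G) (l : ℕ) :
    trajectory (fun s z => occStep m s z.ok) s₀ z l =
      trajectory (occStep m) s₀ (fun l => (z l).ok) l := by
  induction l with
  | zero => rfl
  | succ l ih => simp only [trajectory, ih]

theorem ae_codingLaw_tendsto_flow_div {C : ℝ} {h : (∀ i, Fin (m i + 1)) → ℝ}
    (hP : PoissonEq (patternProb ε) (occStep m) (delivery m) C h) :
    ∀ᵐ z ∂(codingLaw ε m F), Tendsto
      (fun L : ℕ => (flow m (fun l => (z l).ok) (Fin.last r) L : ℝ) / L) atTop (𝓝 C) := by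
  have hP' : PoissonEq (fun z => (epochLaw ε m F).real {z}) (fun s z => occStep m s z.ok)
      (fun s z => delivery m s z.ok) C h := fun s => by
    rw [← hP s]
    exact sum_epochLaw_mul_ok ε m F fun x => delivery m s x + h (occStep m s x)
  filter_upwards [hP'.ae_tendsto fun _ => 0] with z hz
  simpa only [trajectory_comp_ok, sum_delivery m (fun l => (z l).ok)] using hz

variable (m)

/-- For every field the innovation rate exists. It is at most the throughput `C` of the occupancy
chain, and comparison over `T` epochs bounds it from below. -/
theorem exists_innovationRate.{v} (hm : ∀ i, 0 < m i) {C : ℝ}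
    {h : (∀ i, Fin (m i + 1)) → ℝ}
    (hP : PoissonEq (patternProb ε) (occStep m) (delivery m) C h) {b : ℝ} (hb : ∀ s, h s ≤ b) :
    ∃ c, IsInnovationRate.{_, v} ε m F c ∧ c ≤ C ∧ ∀ T : ℕ,
      T * C + h (fun _ => 0) - b - T ^ 2 * (2 * r / Fintype.card F) ≤ T * c := by
  have : Fintype (Submodule F (Coeff m F)) := Fintype.ofFinite _
  obtain ⟨c, k, hc⟩ := exists_poissonEq (real_epochLaw_pos ε m F) (sum_real_epochLaw ε m F)
    (reachable_nextKnown hm) fun (K : Submodule F (Coeff m F)) z => (innovation K z : ℝ)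
  have hrate : ∀ᵐ z ∂(codingLaw ε m F), Tendsto (fun L : ℕ => (∑ l ∈ Finset.range L,
      (innovation (trajectory nextKnown ⊤ z l) (z l) : ℝ)) / L) atTop (𝓝 c) := hc.ae_tendsto ⊤
  refine ⟨c, ?_, ?_, fun T => ?_⟩
  · intro V _ _ src hsrc
    filter_upwards [hrate] with z hz
    simpa only [innovative_eq_sum hsrc, Nat.cast_sum] using hz
  · obtain ⟨z, hz1, hz2⟩ := (hrate.and (ae_codingLaw_tendsto_flow_div ε hP)).exists
    refine le_of_tendsto_of_tendsto' hz1 hz2 fun L => ?_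
    have hsrc := (Finsupp.basisSingleOne (R := F) (ι := ℕ)).linearIndependent
    have h1 := innovative_le_flow (Finsupp.basisSingleOne (R := F) (ι := ℕ)) z L
    rw [innovative_eq_sum hsrc] at h1
    refine div_le_div_of_nonneg_right ?_ (Nat.cast_nonneg L)
    exact_mod_cast h1
  · have h1 := totalReward_le_of_forall_le (real_epochLaw_pos ε m F) (sum_real_epochLaw ε m F)
      hc (T := T) (s₀ := ⊤) fun K => totalReward_innovation_anti ε T le_top
    have h2 := totalReward_delivery_sub_le ε (F := F) hm T (n := fun _ => 0) matches_top
    have h3 := le_totalReward (patternProb_pos ε) (sum_patternProb ε) hP hb T fun _ => 0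
    linarith

end Rate

end LineNetwork

end

open LineNetwork in
theorem mainTheorem1 {r : ℕ} (hr : 1 ≤ r) (ε : Fin (r + 1) → Set.Ioo (0 : ℝ) 1)
    (m : Fin r → ℕ) (hm : ∀ i, 0 < m i) (A : Type*) [Fintype A] [Nontrivial A]
    (F : ℕ → Type*) [∀ l, Field (F l)] [∀ l, Fintype (F l)]
    (hF : Tendsto (fun l => Fintype.card (F l)) atTop atTop) :
    (∃! π, IsStationary ε m π) ∧
    (∀ π, IsStationary ε m π → feedbackCapacity A ε m =
      (1 - (ε (Fin.last r) : ℝ)) *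
        ∑ s with HasPacket (fun i => (s i : ℕ)) (Fin.last r), π s) ∧
    ∃ rate : ℕ → ℝ, (∀ l, IsInnovationRate ε m (F l) (rate l)) ∧
      Tendsto rate atTop (𝓝 (feedbackCapacity A ε m)) := by
  obtain ⟨C, h, hP⟩ := exists_poissonEq (patternProb_pos ε) (sum_patternProb ε)
    (reachable_occStep hm) (delivery m)
  have hcap : feedbackCapacity A ε m = C := feedbackCapacity_eq hm ε (ae_tendsto_flow_div ε hP)
  refine ⟨existsUnique_isStationary ε hm, fun π hπ => by rw [hcap, hP.eq_throughput ε hπ], ?_⟩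
  obtain ⟨a, ha⟩ := Finite.exists_max h
  choose rate hrate hle hge using fun l => exists_innovationRate ε m (F := F l) hm hP ha
  refine ⟨rate, hrate, ?_⟩
  rw [hcap]
  refine tendsto_order.2 ⟨fun b hb => ?_, fun b hb => Eventually.of_forall fun l =>
    (hle l).trans_lt hb⟩
  -- Fix a horizon `T` that makes the boundary effect small, then let the field grow.
  set H := h a - h fun _ => 0
  have h1 : Tendsto (fun T : ℕ => C - H / T) atTop (𝓝 (C - 0)) :=
    tendsto_const_nhds.sub (tendsto_const_div_atTop_nhds_zero_nat H)
  rw [sub_zero] at h1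
  obtain ⟨T, hT, hT0⟩ := ((h1.eventually_const_lt hb).and (eventually_gt_atTop 0)).exists
  have hT0' : (0 : ℝ) < T := by exact_mod_cast hT0
  have h2 : Tendsto (fun l => C - H / T - T * (2 * r / (Fintype.card (F l) : ℝ))) atTop
      (𝓝 (C - H / T - T * 0)) :=
    tendsto_const_nhds.sub (((tendsto_natCast_atTop_atTop.comp hF).const_div_atTop _).const_mul _)
  rw [mul_zero, sub_zero] at h2
  filter_upwards [h2.eventually_const_lt hT] with l hl
  refine hl.trans_le ?_
  have h3 := hge l T
  have h4 : T * (C - H / T - T * (2 * r / (Fintype.card (F l) : ℝ))) ≤ T * rate l := by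
    refine le_trans (le_of_eq ?_) h3
    field_simp
    ring
  exact le_of_mul_le_mul_left h4 hT0'
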